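/- Let $L>0$ and $0<v<1$, and put $\mathbf I_t=(vt,L+vt)$ and $T_v=\frac{2L}{1-v^2}$. Let $S>0$, $\phi^0\in H^1_0(0,L)$, $\phi^1\in L^2(0,L)$, and let $\phi$ be the solution on the time interval $[0,S]$ of $$\phi_{tt}-\phi_{xx}=0\ \ (x\in\mathbf I_t,\ 0<t<S),\qquad \phi(vt,t)=\phi(L+vt,t)=0,\qquad \phi(x,0)=\phi^0(x),\ \ \phi_t(x,0)=\phi^1(x)\ \ (x\in\mathbf I_0),$$ in the class $\phi\in C([0,S];H^1_0(\mathbf I_t))$, $\phi_t\in C([0,S];L^2(\mathbf I_t))$ (continuity being understood after translating $\mathbf I_t$ onto $(0,L)$), where the equation holds in the sense of distributions. Let $$\mathcal E_v(t)=\frac12\int_{vt}^{L+vt}(\phi_t+v\phi_x)^2+(1-v^2)\phi_x^2\,dx .$$ Let $x_b=0$ or $x_b=L$. Then for almost every $t\in(0,S)$ the one-sided derivative $\phi_x(x_b+vt,t)$ of the continuous function $\phi(\cdot,t)$ on $[vt,L+vt]$ exists, it is square integrable as a function of $t\in(0,S)$, and the following hold. 1. For every integer $M\ge 1$ with $MT_v\le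 S$, $$\int_0^{MT_v}\phi_x^2(x_b+vt,t)\,dt=\frac{4M}{(1-v^2)^2}\,\mathcal E_v(0).$$ 2. (Direct inequality.) For every $0\le T\le S$, $$\int_0^{T}\phi_x^2(x_b+vt,t)\,dt\le K_1(v,T)\,\mathcal E_v(0),$$ where, for the given length $L$, the constant $K_1(v,T)$ depends only on $v$ and $T$ (not on $S$, $x_b$, the initial data or the solution). 3. (Observability inequality.) For every $T$ with $T_v\le T\le S$, $$\mathcal E_v(0)\le\frac{(1-v^2)^2}{4}\int_0^{T}\phi_x^2(x_b+vt,t)\,dt .$$ Since $S>0$ is arbitrary, for a solution on $[0,\infty)$ the restrictions $MT_v\le S$ and $T\le S$ disappear. -/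

import Mathlib

open Set Filter Topology MeasureTheory
open scoped ContDiff

namespace TravellingString

/-- `u` restricted to `(a, b)` is (the continuous representative of) an element of `H¹₀(a, b)`:
it is absolutely continuous on `[a, b]`, its derivative is square integrable, and it vanishes
at both ends. -/
structure MemH10 (a b : ℝ) (u : ℝ → ℝ) : Prop where
  absCont : AbsolutelyContinuousOnInterval u a b
  deriv_memLp : MemLp (deriv u) 2 (volume.restrict (Ioo a b))
  left : u a = 0
  right : u b = 0

/-- The partial derivative in space, `φ_x (x, t)`. -/
noncomputable def dx (φ : ℝ → ℝ → ℝ) (x t : ℝ) : ℝ := deriv (fun y => φ y t) x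

/-- `u ∈ C([0, S]; L²(I_t))`, where `I_t = (v t, L + v t)`: every time slice is square integrable
and, after translating `I_t` onto `(0, L)`, the slices depend continuously on `t ∈ [0, S]` in the
norm of `L²(0, L)`. -/
structure ContinuousInL2 (L v S : ℝ) (u : ℝ → ℝ → ℝ) : Prop where
  memLp : ∀ t ∈ Icc 0 S, MemLp (fun y => u (y + v * t) t) 2 (volume.restrict (Ioo 0 L))
  tendsto : ∀ t₀ ∈ Icc 0 S,
    Tendsto (fun t => eLpNorm (fun y => u (y + v * t) t - u (y + v * t₀) t₀) 2
      (volume.restrict (Ioo 0 L))) (𝓝[Icc 0 S] t₀) (𝓝 0)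

/-- The space-time domain `{(x, t) : 0 < t < S, v t < x < L + v t}`. -/
def domain (L v S : ℝ) : Set (ℝ × ℝ) :=
  {p | p.2 ∈ Ioo 0 S ∧ p.1 ∈ Ioo (v * p.2) (L + v * p.2)}

/-- Test functions: smooth functions `η (x, t)` with compact support inside the domain. -/
structure IsTest (L v S : ℝ) (η : ℝ → ℝ → ℝ) : Prop where
  smooth : ContDiff ℝ ∞ (fun p : ℝ × ℝ => η p.1 p.2)
  compact : HasCompactSupport (fun p : ℝ × ℝ => η p.1 p.2)
  supp : tsupport (fun p : ℝ × ℝ => η p.1 p.2) ⊆ domain L v S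

/-- The integral of `g (x, t)` over the space-time domain. -/
noncomputable def domainIntegral (L v S : ℝ) (g : ℝ → ℝ → ℝ) : ℝ :=
  ∫ t in (0 : ℝ)..S, ∫ x in (v * t)..(L + v * t), g x t

/-- `φ`, with weak time derivative `φt`, is a finite-energy solution on the time interval `[0, S]`
of the wave equation `φ_tt = φ_xx` in the moving interval `I_t = (v t, L + v t)` with zero
Dirichlet conditions at both ends and initial data `φ(·, 0) = φ⁰`, `φ_t(·, 0) = φ¹`:
`φ ∈ C([0, S]; H¹₀(I_t))`, `φ_t ∈ C([0, S]; L²(I_t))`, and the equation holds in the sense of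
distributions.  (The boundary conditions are contained in `MemH10`.) -/
structure IsSolution (L v S : ℝ) (φ0 φ1 : ℝ → ℝ) (φ φt : ℝ → ℝ → ℝ) : Prop where
  memH10 : ∀ t ∈ Icc 0 S, MemH10 (v * t) (L + v * t) (fun x => φ x t)
  cont : ContinuousInL2 L v S φ
  cont_dx : ContinuousInL2 L v S (dx φ)
  cont_dt : ContinuousInL2 L v S φt
  weak_dt : ∀ η, IsTest L v S η →
    domainIntegral L v S (fun x t => φ x t * deriv (fun s => η x s) t) =
      - domainIntegral L v S (fun x t => φt x t * η x t)
  wave : ∀ η, IsTest L v S η →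
    domainIntegral L v S (fun x t => φ x t *
      (iteratedDeriv 2 (fun s => η x s) t - iteratedDeriv 2 (fun y => η y t) x)) = 0
  init : ∀ x ∈ Ioo 0 L, φ x 0 = φ0 x
  init_dt : ∀ᵐ x ∂(volume.restrict (Ioo 0 L)), φt x 0 = φ1 x

/-- The energy
`𝓔_v(t) = ½ ∫_{v t}^{L + v t} (φ_t + v φ_x)² + (1 - v²) φ_x² dx`. -/
noncomputable def energy (L v : ℝ) (φ φt : ℝ → ℝ → ℝ) (t : ℝ) : ℝ :=
  (1 / 2) * ∫ x in (v * t)..(L + v * t),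
    ((φt x t + v * dx φ x t) ^ 2 + (1 - v ^ 2) * (dx φ x t) ^ 2)

/-- `T_v = 2 L / (1 - v²)`. -/
noncomputable def obsTime (L v : ℝ) : ℝ := 2 * L / (1 - v ^ 2)

/-- The boundary value `φ_x (x_b + v t, t)`: the one-sided derivative of `φ(·, t)`, taken from
inside `[v t, L + v t]`, at the end point `x_b + v t`. -/
noncomputable def bdryDx (L v : ℝ) (φ : ℝ → ℝ → ℝ) (xb t : ℝ) : ℝ :=
  derivWithin (fun x => φ x t) (Icc (v * t) (L + v * t)) (xb + v * t)

end TravellingString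

/-!
A finite-energy solution is a pair of travelling waves. With `λ = (1 + v) / (1 - v)` and
`P = L + λ L = 2 L / (1 - v)`, the two boundary conditions force
`φ(x, t) = f(t + x) - f(λ (t - x))` for a single absolutely continuous function `f` of period `P`,
with `f' = w` square integrable over a period (`IsSolution.exists_profile`). Everything is then a
change of variables. The energy `𝓔_v(0)` is `(1 + v) ∫ w²` over one period; at either end point the
two waves contribute the same value `w (x_b + (1 + v) t)` up to the factor `λ`
(`hasDerivWithinAt_bdry`), so `φ_x(x_b + v t, t) = (1 + λ) w (x_b + (1 + v) t)` for almost every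
`t`; and a time interval of length `T_v` corresponds to exactly one period of `w`. Covering `[0, T]`
by `⌊T / T_v⌋ + 1` periods gives the direct inequality, and keeping one period the observability
inequality.

The work lies in obtaining the representation from the weak formulation. Testing the wave equation
with products `a (t + x) b (t - x)` of smoothed indicators shows that the continuous function `φ`
has equal sums over opposite vertices of characteristic rectangles
(`IsSolution.rectangleIdentity`). By this identity the mean of `φ(·, t)` over `[x - h, x + h]` is
the mean of `φ(x, ·)` over `[t - h, t + h]`, whose derivative in `t` is explicit, so the weak
identity between `φ` and `φ_t` yields d'Alembert's formula, at first on diamonds inside the domain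
and then on the triangle over `[0, L]` (`IsSolution.dAlembert`). The initial data thus determine the
candidate `f`, and the difference of `φ` and the candidate satisfies the parallelogram identity and
vanishes on the sides and on that triangle, hence everywhere (`RectangleIdentity.eq_zero`).
-/

namespace TravellingString

/-! ### Continuity in time, and up to the boundary -/

theorem ContinuousInL2.integrableOn {L v S : ℝ} {u : ℝ → ℝ → ℝ} (hu : ContinuousInL2 L v S u)
    {t : ℝ} (ht : t ∈ Icc 0 S) : IntegrableOn (fun y => u (y + v * t) t) (Ioo 0 L) :=
  (hu.memLp t ht).integrable (by norm_num)

/-- Continuity in `L²` gives continuity in `L¹`, since the interval is bounded. -/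
theorem ContinuousInL2.tendsto_integral_abs_sub {L v S : ℝ} {u : ℝ → ℝ → ℝ}
    (hu : ContinuousInL2 L v S u) {t₀ : ℝ} (ht₀ : t₀ ∈ Icc 0 S) :
    Tendsto (fun t => ∫ y in Ioo 0 L, |u (y + v * t) t - u (y + v * t₀) t₀|)
      (𝓝[Icc 0 S] t₀) (𝓝 0) := by
  have h1 : Tendsto (fun t => eLpNorm (fun y => u (y + v * t) t - u (y + v * t₀) t₀) 1
      (volume.restrict (Ioo 0 L))) (𝓝[Icc 0 S] t₀) (𝓝 0) := by
    have hC : (volume.restrict (Ioo 0 L)) univ ^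
        (1 / (1 : ENNReal).toReal - 1 / (2 : ENNReal).toReal) ≠ ⊤ := by
      apply ENNReal.rpow_ne_top_of_nonneg
      · norm_num
      · simp
    have h2 := ENNReal.Tendsto.mul_const (hu.tendsto t₀ ht₀) (Or.inr hC)
    rw [zero_mul] at h2
    refine tendsto_of_tendsto_of_tendsto_of_le_of_le' tendsto_const_nhds h2
      (Eventually.of_forall fun _ => zero_le) ?_
    filter_upwards [self_mem_nhdsWithin] with t ht
    exact eLpNorm_le_eLpNorm_mul_rpow_measure_univ (by norm_num)
      (((hu.memLp t ht).sub (hu.memLp t₀ ht₀)).1)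
  have h3 := (ENNReal.tendsto_toReal ENNReal.zero_ne_top).comp h1
  rw [ENNReal.toReal_zero] at h3
  refine h3.congr' ?_
  filter_upwards [self_mem_nhdsWithin] with t ht
  have := (hu.integrableOn ht).sub (hu.integrableOn ht₀)
  simp only [Function.comp_apply, eLpNorm_one_eq_lintegral_enorm]
  exact (integral_norm_eq_lintegral_enorm this.1).symm

theorem integral_moving_interval {L v t : ℝ} (hL : 0 < L) (g : ℝ → ℝ) :
    ∫ x in (v * t)..(L + v * t), g x = ∫ y in Ioo 0 L, g (y + v * t) := by
  rw [← integral_Ioc_eq_integral_Ioo, ← intervalIntegral.integral_of_le hL.le,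
    intervalIntegral.integral_comp_add_right]
  simp

/-- Testing a curve in `L²` against a fixed bounded weight, continuous almost everywhere, gives
a continuous function of time. -/
theorem ContinuousInL2.continuousOn_integral_mul {L v S : ℝ} (hL : 0 < L) {u : ℝ → ℝ → ℝ}
    (hu : ContinuousInL2 L v S u) {α : ℝ → ℝ} {C : ℝ} (hm : Measurable α) (hb : ∀ x, |α x| ≤ C)
    (hc : ∀ᵐ x, ContinuousAt α x) :
    ContinuousOn (fun t => ∫ x in (v * t)..(L + v * t), u x t * α x) (Icc 0 S) := by
  intro t₀ ht₀
  have hint : ∀ t ∈ Icc 0 S, ∀ s, Integrable (fun y => u (y + v * t) t * α (y + v * s))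
      (volume.restrict (Ioo 0 L)) := fun t ht s =>
    (hu.integrableOn ht).mul_bdd (c := C)
      (hm.comp (measurable_id.add_const _)).aestronglyMeasurable
      (Eventually.of_forall fun y => by simpa using hb _)
  have h2 : Tendsto (fun t => ∫ y in Ioo 0 L, u (y + v * t₀) t₀ * α (y + v * t))
      (𝓝[Icc 0 S] t₀) (𝓝 (∫ y in Ioo 0 L, u (y + v * t₀) t₀ * α (y + v * t₀))) := by
    refine tendsto_integral_filter_of_dominated_convergence
      (fun y => |u (y + v * t₀) t₀| * C) ?_ ?_ ?_ ?_
    · exact Eventually.of_forall fun t => (hint t₀ ht₀ t).1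
    · refine Eventually.of_forall fun t => Eventually.of_forall fun y => ?_
      rw [norm_mul]
      exact mul_le_mul_of_nonneg_left (hb _) (abs_nonneg _)
    · exact (hu.integrableOn ht₀).norm.mul_const C
    · refine ae_restrict_of_ae ?_
      have := (measurePreserving_add_right volume (v * t₀)).quasiMeasurePreserving.ae hc
      filter_upwards [this] with y hy
      refine Tendsto.const_mul _ (Tendsto.mono_left ?_ nhdsWithin_le_nhds)
      exact (ContinuousAt.comp (f := fun t => y + v * t) (x := t₀) hy (by fun_prop))
  have h1 : Tendsto (fun t => ∫ y in Ioo 0 L,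
      (u (y + v * t) t - u (y + v * t₀) t₀) * α (y + v * t)) (𝓝[Icc 0 S] t₀) (𝓝 0) := by
    have h3 := (hu.tendsto_integral_abs_sub ht₀).mul_const C
    rw [zero_mul] at h3
    refine squeeze_zero_norm' ?_ h3
    filter_upwards [self_mem_nhdsWithin] with t ht
    rw [← integral_mul_const]
    refine norm_integral_le_of_norm_le
      (((hu.integrableOn ht).sub (hu.integrableOn ht₀)).norm.mul_const C)
      (Eventually.of_forall fun y => ?_)
    rw [norm_mul]
    exact mul_le_mul_of_nonneg_left (hb _) (abs_nonneg _)
  have h4 := h1.add h2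
  rw [zero_add] at h4
  unfold ContinuousWithinAt
  simp only [integral_moving_interval hL]
  refine h4.congr' ?_
  filter_upwards [self_mem_nhdsWithin] with t ht
  rw [← integral_add]
  · congr 1; ext y; ring
  · simp only [sub_mul]
    exact (hint t ht t).sub (hint t₀ ht₀ t)
  · exact hint t₀ ht₀ t

theorem ContinuousInL2.intervalIntegrable {L v S : ℝ} (hL : 0 < L) {u : ℝ → ℝ → ℝ}
    (hu : ContinuousInL2 L v S u) {t : ℝ} (ht : t ∈ Icc 0 S) :
    IntervalIntegrable (fun x => u x t) volume (v * t) (L + v * t) := by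
  have h := hu.integrableOn ht
  rw [← integrableOn_Ioc_iff_integrableOn_Ioo,
    ← intervalIntegrable_iff_integrableOn_Ioc_of_le hL.le] at h
  simpa using h.comp_sub_right (v * t)

theorem ContinuousInL2.exists_bound {L v S : ℝ} (hL : 0 < L) {u : ℝ → ℝ → ℝ}
    (hu : ContinuousInL2 L v S u) :
    ∃ C, ∀ t ∈ Icc 0 S, ∫ x in (v * t)..(L + v * t), |u x t| ≤ C := by
  have hc : ContinuousOn (fun t => ∫ x in (v * t)..(L + v * t), |u x t|) (Icc 0 S) := by
    intro t₀ ht₀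
    unfold ContinuousWithinAt
    simp only [integral_moving_interval hL]
    rw [tendsto_iff_dist_tendsto_zero]
    refine squeeze_zero' (Eventually.of_forall fun _ => dist_nonneg) ?_
      (hu.tendsto_integral_abs_sub ht₀)
    filter_upwards [self_mem_nhdsWithin] with t ht
    rw [Real.dist_eq, ← integral_sub (hu.integrableOn ht).abs (hu.integrableOn ht₀).abs]
    refine norm_integral_le_of_norm_le (f := fun y => |u (y + v * t) t| - |u (y + v * t₀) t₀|)
      ((hu.integrableOn ht).sub (hu.integrableOn ht₀)).norm
      (Eventually.of_forall fun y => ?_)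
    exact abs_abs_sub_abs_le _ _
  obtain ⟨C, hC⟩ := isCompact_Icc.exists_bound_of_continuousOn hc
  exact ⟨C, fun t ht => (le_abs_self _).trans (hC t ht)⟩

/-- Passage to the limit in the space factor of a product weight. -/
theorem ContinuousInL2.tendsto_domainIntegral {L v S : ℝ} (hL : 0 < L) (hS : 0 < S)
    {u : ℝ → ℝ → ℝ}
    (hu : ContinuousInL2 L v S u) {α : ℕ → ℝ → ℝ} {α' γ : ℝ → ℝ} (hα : ∀ n, Continuous (α n))
    (hb : ∀ n x, |α n x| ≤ 1) (hlim : ∀ x, Tendsto (fun n => α n x) atTop (𝓝 (α' x)))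
    (hγ : Continuous γ) :
    Tendsto (fun n => domainIntegral L v S (fun x t => u x t * (α n x * γ t))) atTop
      (𝓝 (∫ t in (0 : ℝ)..S, (∫ x in (v * t)..(L + v * t), u x t * α' x) * γ t)) := by
  obtain ⟨C, hC⟩ := hu.exists_bound hL
  unfold domainIntegral
  simp only [← mul_assoc, intervalIntegral.integral_mul_const]
  have hle : ∀ t, v * t ≤ L + v * t := fun t => by linarith
  refine intervalIntegral.tendsto_integral_filter_of_dominated_convergence
    (fun t => C * |γ t|) ?_ ?_ ?_ ?_
  · refine Eventually.of_forall fun n => ?_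
    have h1 := hu.continuousOn_integral_mul hL (hα n).measurable (hb n)
      (Eventually.of_forall fun x => (hα n).continuousAt)
    rw [uIoc_of_le hS.le]
    exact ((h1.mul hγ.continuousOn).mono Ioc_subset_Icc_self).aestronglyMeasurable
      measurableSet_Ioc
  · refine Eventually.of_forall fun n => Eventually.of_forall fun t ht => ?_
    rw [uIoc_of_le hS.le] at ht
    rw [norm_mul]
    refine mul_le_mul_of_nonneg_right ?_ (abs_nonneg _)
    refine le_trans ?_ (hC t (Ioc_subset_Icc_self ht))
    refine intervalIntegral.norm_integral_le_of_norm_le (hle t)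
      (Eventually.of_forall fun x _ => ?_) (hu.intervalIntegrable hL (Ioc_subset_Icc_self ht)).abs
    rw [norm_mul]
    exact mul_le_of_le_one_right (abs_nonneg _) (hb n x)
  · exact (continuous_const.mul hγ.abs).intervalIntegrable _ _
  · refine Eventually.of_forall fun t ht => Tendsto.mul_const _ ?_
    rw [uIoc_of_le hS.le] at ht
    have hi := hu.intervalIntegrable hL (Ioc_subset_Icc_self ht)
    refine intervalIntegral.tendsto_integral_filter_of_dominated_convergence
      (fun x => |u x t|) ?_ ?_ hi.abs ?_
    · refine Eventually.of_forall fun n => ?_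
      exact hi.def'.1.mul (hα n).aestronglyMeasurable
    · refine Eventually.of_forall fun n => Eventually.of_forall fun x _ => ?_
      rw [norm_mul]
      exact mul_le_of_le_one_right (abs_nonneg _) (hb n x)
    · exact Eventually.of_forall fun x _ => (hlim x).const_mul _

/-- A finite-energy solution is continuous up to the boundary; it is extended here to a continuous
function on the whole plane. -/
theorem IsSolution.exists_continuous_extension {L v S : ℝ} (hL : 0 < L) (hS : 0 < S)
    {φ0 φ1 : ℝ → ℝ} {φ φt : ℝ → ℝ → ℝ} (h : IsSolution L v S φ0 φ1 φ φt) :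
    ∃ u : ℝ → ℝ → ℝ, Continuous (fun z : ℝ × ℝ => u z.1 z.2) ∧
      ∀ t ∈ Icc 0 S, ∀ x ∈ Icc (v * t) (L + v * t), u x t = φ x t := by
  have hac : ∀ t ∈ Icc 0 S, ∀ y ∈ Icc 0 L,
      φ (y + v * t) t = ∫ z in (0 : ℝ)..y, dx φ (z + v * t) t := by
    intro t ht y hy
    have h1 := (h.memH10 t ht).absCont.mono (c := v * t) (d := y + v * t) (by
      rw [uIcc_of_le (by linarith [hy.1]), uIcc_of_le (by linarith)]
      exact Icc_subset_Icc_right (by linarith [hy.2]))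
    have h2 := h1.integral_deriv_eq_sub
    rw [(h.memH10 t ht).left, sub_zero] at h2
    rw [← h2, intervalIntegral.integral_comp_add_right (fun x => dx φ x t)]
    simp [dx]
  -- the solution in the coordinates of the moving interval, with both coordinates clamped
  let Y : ℝ → ℝ := fun y => projIcc 0 L hL.le y
  let Z : ℝ → ℝ := fun t => projIcc 0 S hS.le t
  have hYc : Continuous Y := continuous_subtype_val.comp continuous_projIcc
  have hZc : Continuous Z := continuous_subtype_val.comp continuous_projIcc
  have hY : ∀ y, Y y ∈ Icc 0 L := fun y => (projIcc 0 L hL.le y).2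
  have hZ : ∀ y, Z y ∈ Icc 0 S := fun y => (projIcc 0 S hS.le y).2
  let V : ℝ × ℝ → ℝ := fun z => φ (Y z.1 + v * Z z.2) (Z z.2)
  have hV : Continuous V := by
    rw [continuous_iff_continuousAt]
    rintro ⟨y₀, t₀⟩
    have h1 : Tendsto (fun z : ℝ × ℝ => ∫ y in Ioo 0 L,
        |dx φ (y + v * Z z.2) (Z z.2) - dx φ (y + v * Z t₀) (Z t₀)|)
        (𝓝 (y₀, t₀)) (𝓝 0) := by
      refine (h.cont_dx.tendsto_integral_abs_sub (hZ t₀)).comp (f := fun z : ℝ × ℝ => Z z.2) ?_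
      rw [tendsto_nhdsWithin_iff]
      exact ⟨(hZc.comp continuous_snd).continuousAt (x := (y₀, t₀)),
        Eventually.of_forall fun z => hZ _⟩
    have h2 : Tendsto (fun z : ℝ × ℝ => φ (Y z.1 + v * Z t₀) (Z t₀)) (𝓝 (y₀, t₀))
        (𝓝 (V (y₀, t₀))) := by
      have hc : ContinuousOn (fun x => φ x (Z t₀)) (Icc (v * Z t₀) (L + v * Z t₀)) := by
        have := (h.memH10 _ (hZ t₀)).absCont.continuousOn
        rwa [uIcc_of_le (by linarith)] at this
      have : Continuous (fun z : ℝ × ℝ => φ (Y z.1 + v * Z t₀) (Z t₀)) :=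
        hc.comp_continuous (f := fun z : ℝ × ℝ => Y z.1 + v * Z t₀)
          ((hYc.comp continuous_fst).add_const _)
          (fun z => ⟨by linarith [(hY z.1).1], by linarith [(hY z.1).2]⟩)
      exact this.continuousAt (x := (y₀, t₀))
    have h3 : Tendsto (fun z : ℝ × ℝ => V z - φ (Y z.1 + v * Z t₀) (Z t₀)) (𝓝 (y₀, t₀))
        (𝓝 0) := by
      refine squeeze_zero_norm (fun z => ?_) h1
      have hi := fun t => h.cont_dx.integrableOn (hZ t)
      have hi' : ∀ t, IntervalIntegrable (fun y => dx φ (y + v * Z t) (Z t)) volume 0 (Y z.1) := by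
        intro t
        rw [intervalIntegrable_iff_integrableOn_Ioo_of_le (hY _).1]
        exact (hi t).mono_set (Ioo_subset_Ioo_right (hY _).2)
      simp only [V]
      rw [hac _ (hZ z.2) _ (hY z.1), hac _ (hZ t₀) _ (hY z.1),
        ← intervalIntegral.integral_sub (hi' _) (hi' _), intervalIntegral.integral_of_le (hY _).1,
        integral_Ioc_eq_integral_Ioo]
      refine (norm_integral_le_integral_norm _).trans ?_
      refine setIntegral_mono_set ((hi _).sub (hi _)).norm
        (Eventually.of_forall fun _ => norm_nonneg _) ?_
      exact (Ioo_subset_Ioo_right (hY _).2).eventuallyLE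
    simpa [ContinuousAt] using h3.add h2
  refine ⟨fun x t => V (x - v * t, t), hV.comp (by fun_prop), fun t ht x hx => ?_⟩
  have e1 : Y (x - v * t) = x - v * t := by
    simp only [Y]
    rw [projIcc_of_mem hL.le ⟨by linarith [hx.1], by linarith [hx.2]⟩]
  have e2 : Z t = t := by simp only [Z]; rw [projIcc_of_mem hS.le ht]
  simp only [V, e1, e2, sub_add_cancel]

/-! ### The characteristic parallelogram identity -/

/-- A smooth bump `ρ` supported in `[-ε, ε]`, with a smooth primitive `R` (a mollified step). -/
theorem exists_bump_primitive {ε : ℝ} (hε : 0 < ε) :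
    ∃ ρ R : ℝ → ℝ, ContDiff ℝ ∞ ρ ∧ ContDiff ℝ ∞ R ∧ (∀ s, HasDerivAt R (ρ s) s) ∧
      (∀ s, 0 ≤ ρ s) ∧ (∀ s, ε ≤ |s| → ρ s = 0) ∧ 0 < ρ 0 ∧ (∀ s, s ≤ -ε → R s = 0) ∧
      (∀ s, ε ≤ s → R s = R ε) := by
  let ρ : ContDiffBump (0 : ℝ) := ⟨ε / 2, ε, by positivity, by linarith⟩
  have hρ : ContDiff ℝ ∞ ρ := ρ.contDiff
  have hd : ∀ s, HasDerivAt (fun s => ∫ r in (-ε)..s, ρ r) (ρ s) s := fun s =>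
    intervalIntegral.integral_hasDerivAt_right (hρ.continuous.intervalIntegrable _ _)
      hρ.continuous.stronglyMeasurable.stronglyMeasurableAtFilter hρ.continuous.continuousAt
  have hz : ∀ s, ε ≤ |s| → ρ s = 0 := fun s hs =>
    ρ.zero_of_le_dist (by simpa [Real.dist_eq] using hs)
  refine ⟨ρ, fun s => ∫ r in (-ε)..s, ρ r, hρ, ?_, hd, fun s => ρ.nonneg, hz, ?_, ?_, ?_⟩
  · rw [contDiff_infty_iff_deriv]
    refine ⟨fun s => (hd s).differentiableAt, ?_⟩
    rw [show deriv (fun s => ∫ r in (-ε)..s, ρ r) = ρ from funext fun s => (hd s).deriv]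
    exact hρ
  · refine ρ.pos_of_mem_ball ?_
    simpa [ρ] using hε
  · intro s hs
    refine intervalIntegral.integral_zero_ae (Eventually.of_forall fun r hr => ?_)
    rw [uIoc_of_ge hs] at hr
    exact hz r (by rw [abs_of_neg (by linarith [hr.2])]; linarith [hr.2])
  · intro s hs
    simp only
    rw [← intervalIntegral.integral_add_adjacent_intervals (b := ε)
      (hρ.continuous.intervalIntegrable _ _) (hρ.continuous.intervalIntegrable _ _),
      add_eq_left]
    refine intervalIntegral.integral_zero_ae (Eventually.of_forall fun r hr => ?_)
    rw [uIoc_of_le hs] at hr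
    exact hz r (by rw [abs_of_pos (by linarith [hr.1])]; linarith [hr.1])

/-- In characteristic coordinates the wave operator is `4 ∂² / ∂ξ ∂ζ`. -/
theorem wave_operator_mul {a b a' b' a'' b'' : ℝ → ℝ} (ha : ∀ s, HasDerivAt a (a' s) s)
    (ha' : ∀ s, HasDerivAt a' (a'' s) s) (hb : ∀ s, HasDerivAt b (b' s) s)
    (hb' : ∀ s, HasDerivAt b' (b'' s) s) (x t : ℝ) :
    iteratedDeriv 2 (fun s => a (s + x) * b (s - x)) t -
      iteratedDeriv 2 (fun y => a (t + y) * b (t - y)) x = 4 * (a' (t + x) * b' (t - x)) := by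
  have e1 : ∀ s, HasDerivAt (fun s => a (s + x) * b (s - x))
      (a' (s + x) * b (s - x) + a (s + x) * b' (s - x)) s := fun s =>
    ((ha _).comp_add_const s x).mul ((hb _).comp_sub_const s x)
  have e2 : HasDerivAt (fun s => a' (s + x) * b (s - x) + a (s + x) * b' (s - x))
      (a'' (t + x) * b (t - x) + a' (t + x) * b' (t - x) +
        (a' (t + x) * b' (t - x) + a (t + x) * b'' (t - x))) t :=
    (((ha' _).comp_add_const t x).mul ((hb _).comp_sub_const t x)).add
      (((ha _).comp_add_const t x).mul ((hb' _).comp_sub_const t x))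
  have e3 : ∀ y, HasDerivAt (fun y => a (t + y) * b (t - y))
      (a' (t + y) * b (t - y) + a (t + y) * -b' (t - y)) y := fun y =>
    ((ha _).comp_const_add t y).mul ((hb _).comp_const_sub t y)
  have e4 : HasDerivAt (fun y => a' (t + y) * b (t - y) + a (t + y) * -b' (t - y))
      (a'' (t + x) * b (t - x) + a' (t + x) * -b' (t - x) +
        (a' (t + x) * -b' (t - x) + a (t + x) * - -b'' (t - x))) x :=
    (((ha' _).comp_const_add t x).mul ((hb _).comp_const_sub t x)).add
      (((ha _).comp_const_add t x).mul ((hb' _).comp_const_sub t x).neg)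
  simp only [iteratedDeriv_succ, iteratedDeriv_zero]
  rw [funext fun s => (e1 s).deriv, funext fun s => (e3 s).deriv, e2.deriv, e4.deriv]
  ring

theorem domainIntegral_eq_integral {L v S : ℝ} (hL : 0 < L) (hS : 0 < S) {g : ℝ → ℝ → ℝ}
    (hg : Integrable (fun z : ℝ × ℝ => g z.1 z.2))
    (h0 : ∀ z : ℝ × ℝ, z ∉ domain L v S → g z.1 z.2 = 0) :
    domainIntegral L v S g = ∫ z : ℝ × ℝ, g z.1 z.2 := by
  rw [Measure.volume_eq_prod] at hg ⊢
  rw [integral_prod_symm _ hg]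
  unfold domainIntegral
  rw [intervalIntegral.integral_of_le hS.le, integral_Ioc_eq_integral_Ioo,
    ← setIntegral_eq_integral_of_forall_compl_eq_zero (s := Ioo 0 S) (μ := volume)
      (f := fun t => ∫ x, g x t)]
  · refine setIntegral_congr_fun measurableSet_Ioo fun t ht => ?_
    rw [intervalIntegral.integral_of_le (by linarith : v * t ≤ L + v * t), integral_Ioc_eq_integral_Ioo,
      setIntegral_eq_integral_of_forall_compl_eq_zero]
    exact fun x hx => h0 (x, t) fun h => hx h.2
  · intro t ht
    have : ∀ x, g x t = 0 := fun x => h0 (x, t) fun h => ht h.1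
    simp [this]

theorem domainIntegral_congr {L v S : ℝ} (hL : 0 < L) (hS : 0 < S) {g g' : ℝ → ℝ → ℝ}
    (h : ∀ t ∈ Icc 0 S, ∀ x ∈ Icc (v * t) (L + v * t), g x t = g' x t) :
    domainIntegral L v S g = domainIntegral L v S g' := by
  refine intervalIntegral.integral_congr fun t ht => intervalIntegral.integral_congr fun x hx => ?_
  rw [uIcc_of_le hS.le] at ht
  rw [uIcc_of_le (by linarith)] at hx
  exact h t ht x hx

/-- Translates of a nonnegative kernel concentrated near the origin evaluate a continuous
function, up to its oscillation. -/
theorem abs_integral_mul_sub_le {u k : ℝ × ℝ → ℝ} (hu : Continuous u) (hk : Continuous k)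
    (hkc : HasCompactSupport k) (hk0 : ∀ z, 0 ≤ k z) {z₀ : ℝ × ℝ} {δ : ℝ}
    (h : ∀ z, k (z - z₀) ≠ 0 → |u z - u z₀| ≤ δ) :
    |(∫ z, u z * k (z - z₀)) - u z₀ * ∫ z, k z| ≤ δ * ∫ z, k z := by
  have hk' : Continuous fun z => k (z - z₀) := hk.comp (continuous_id.sub continuous_const)
  have hkc' : HasCompactSupport fun z => k (z - z₀) :=
    hkc.comp_homeomorph (Homeomorph.subRight z₀)
  have hi : Integrable fun z => k (z - z₀) := hk'.integrable_of_hasCompactSupport hkc'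
  have hi' : Integrable fun z => u z * k (z - z₀) :=
    (hu.mul hk').integrable_of_hasCompactSupport hkc'.mul_left
  rw [← integral_sub_right_eq_self k z₀, ← integral_const_mul, ← integral_const_mul,
    ← integral_sub hi' (hi.const_mul _)]
  refine norm_integral_le_of_norm_le (f := fun z => u z * k (z - z₀) - u z₀ * k (z - z₀))
    (hi.const_mul δ) (Eventually.of_forall fun z => ?_)
  rw [← sub_mul, norm_mul, Real.norm_of_nonneg (hk0 _)]
  by_cases hz : k (z - z₀) = 0
  · simp [hz]
  · exact mul_le_mul_of_nonneg_right (h z hz) (hk0 _)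

/-- `u` satisfies the characteristic parallelogram identity on every characteristic rectangle,
with lowest corner `(x, t)`, in the closed space-time domain. -/
def RectangleIdentity (L v S : ℝ) (u : ℝ → ℝ → ℝ) : Prop :=
  ∀ x t a b : ℝ, 0 ≤ a → 0 ≤ b → 0 ≤ t → t + a + b ≤ S → v * (t + b) ≤ x - b →
    x + a ≤ L + v * (t + a) →
    u x t + u (x + a - b) (t + a + b) = u (x + a) (t + a) + u (x - b) (t + b)

theorem integral_add_sub_sub {f₁ f₂ f₃ f₄ : ℝ × ℝ → ℝ} (h₁ : Integrable f₁)
    (h₂ : Integrable f₂) (h₃ : Integrable f₃) (h₄ : Integrable f₄) :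
    ∫ z, (f₁ z + f₂ z - f₃ z - f₄ z) =
      (∫ z, f₁ z) + (∫ z, f₂ z) - (∫ z, f₃ z) - ∫ z, f₄ z := by
  rw [integral_sub (f := fun z => f₁ z + f₂ z - f₃ z) ((h₁.add h₂).sub h₃) h₄,
    integral_sub (f := fun z => f₁ z + f₂ z) (h₁.add h₂) h₃, integral_add h₁ h₂]

/-- The identity in the open domain.  For smoothed indicators `a`, `b` of the two sides of the
rectangle, `4 a' b'` is a signed sum of four bumps at the vertices, which shrink to points. -/
theorem rectangle_identity_of_wave {L v S : ℝ} (hL : 0 < L) (hv0 : 0 < v) (hv1 : v < 1)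
    {u : ℝ → ℝ → ℝ} (hu : Continuous (fun z : ℝ × ℝ => u z.1 z.2))
    (hw : ∀ η, IsTest L v S η → domainIntegral L v S (fun x t => u x t *
      (iteratedDeriv 2 (fun s => η x s) t - iteratedDeriv 2 (fun y => η y t) x)) = 0)
    {x t a b : ℝ} (ha : 0 ≤ a) (hb : 0 ≤ b) (h1 : 0 < t) (h2 : t + a + b < S)
    (h3 : v * (t + b) < x - b) (h4 : x + a < L + v * (t + a)) :
    u x t + u (x + a - b) (t + a + b) = u (x + a) (t + a) + u (x - b) (t + b) := by
  have hS : 0 < S := by linarith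
  suffices hδ : ∀ δ > 0, |u x t + u (x + a - b) (t + a + b) - u (x + a) (t + a)
      - u (x - b) (t + b)| ≤ 4 * δ by
    have h0 : |u x t + u (x + a - b) (t + a + b) - u (x + a) (t + a) - u (x - b) (t + b)| ≤ 0 :=
      le_of_forall_pos_le_add fun δ hδ' => by
        have := hδ (δ / 4) (by positivity)
        linarith
    linarith [abs_nonpos_iff.1 h0]
  intro δ hδ
  -- the radius on which `u` oscillates by at most `δ` about each of the four corners
  have hosc : ∀ z₀ : ℝ × ℝ, ∃ ε > 0, ∀ z : ℝ × ℝ, dist z z₀ < ε →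
      |u z.1 z.2 - u z₀.1 z₀.2| ≤ δ := fun z₀ => by
    obtain ⟨ε, h, h'⟩ := Metric.continuous_iff.1 hu z₀ δ hδ
    exact ⟨ε, h, fun z hz => (h' z hz).le⟩
  obtain ⟨ε₁, hε₁, hu₁⟩ := hosc (x, t)
  obtain ⟨ε₂, hε₂, hu₂⟩ := hosc (x + a - b, t + a + b)
  obtain ⟨ε₃, hε₃, hu₃⟩ := hosc (x + a, t + a)
  obtain ⟨ε₄, hε₄, hu₄⟩ := hosc (x - b, t + b)
  obtain ⟨ε, hε, hεlt⟩ : ∃ ε > 0, ε < ε₁ ∧ ε < ε₂ ∧ ε < ε₃ ∧ ε < ε₄ ∧ ε < t ∧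
      ε < S - (t + a + b) ∧ ε < x - b - v * (t + b) ∧ ε < L + v * (t + a) - (x + a) := by
    have hm : 0 < min (min (min ε₁ ε₂) (min ε₃ ε₄)) (min (min t (S - (t + a + b)))
        (min (x - b - v * (t + b)) (L + v * (t + a) - (x + a)))) := by
      simp only [lt_min_iff]
      refine ⟨⟨⟨hε₁, hε₂⟩, hε₃, hε₄⟩, ⟨h1, ?_⟩, ?_, ?_⟩ <;> linarith
    obtain ⟨ε, h, h'⟩ := exists_between hm
    simp only [lt_min_iff] at h'
    exact ⟨ε, h, by tauto⟩
  obtain ⟨g1, g2, g3, g4, g5, g6, g7, g8⟩ := hεlt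
  obtain ⟨ρ, R, hρ, hR, hRd, hρ0, hρz, hρp, hRl, hRr⟩ := exists_bump_primitive hε
  have hρd : ∀ s, HasDerivAt ρ (deriv ρ s) s := fun s =>
    ((hρ.differentiable (by simp)) s).hasDerivAt
  -- the two factors of the test function: smoothed indicators of the sides of the rectangle
  let A : ℝ → ℝ → ℝ → ℝ := fun p q s => R (s - p) - R (s - q)
  have hAd : ∀ p q s, HasDerivAt (A p q) (ρ (s - p) - ρ (s - q)) s := fun p q s =>
    ((hRd _).comp_sub_const s p).sub ((hRd _).comp_sub_const s q)
  have hAd' : ∀ p q s, HasDerivAt (fun s => ρ (s - p) - ρ (s - q))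
      (deriv ρ (s - p) - deriv ρ (s - q)) s := fun p q s =>
    ((hρd _).comp_sub_const s p).sub ((hρd _).comp_sub_const s q)
  have hAz : ∀ p q s, p ≤ q → s ∉ Icc (p - ε) (q + ε) → A p q s = 0 := by
    intro p q s hpq hs
    simp only [A]
    rcases lt_or_ge s (p - ε) with h | h
    · rw [hRl _ (by linarith), hRl _ (by linarith), sub_zero]
    · have : q + ε < s := by by_contra h'; exact hs ⟨h, by linarith⟩
      rw [hRr _ (by linarith), hRr (s - q) (by linarith), sub_self]
  let K : Set (ℝ × ℝ) := {z | z.2 + z.1 ∈ Icc (t + x - ε) (t + x + 2 * a + ε) ∧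
    z.2 - z.1 ∈ Icc (t - x - ε) (t - x + 2 * b + ε)}
  have hKcl : IsClosed K :=
    (isClosed_Icc.preimage (continuous_snd.add continuous_fst)).inter
      (isClosed_Icc.preimage (continuous_snd.sub continuous_fst))
  have hKc : IsCompact K := by
    refine IsCompact.of_isClosed_subset (isCompact_Icc (a := x - b - ε) (b := x + a + ε) |>.prod
      (isCompact_Icc (a := t - ε) (b := t + a + b + ε))) hKcl ?_
    rintro ⟨y, s⟩ ⟨⟨i1, i2⟩, i3, i4⟩
    simp only at i1 i2 i3 i4
    refine ⟨⟨?_, ?_⟩, ?_, ?_⟩ <;> simp only <;> linarith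
  have hKd : K ⊆ domain L v S := by
    rintro ⟨y, s⟩ ⟨⟨i1, i2⟩, i3, i4⟩
    simp only at i1 i2 i3 i4
    refine ⟨⟨?_, ?_⟩, ?_, ?_⟩ <;> simp only <;> nlinarith
  have htest : IsTest L v S (fun y s => A (t + x) (t + x + 2 * a) (s + y) *
      A (t - x) (t - x + 2 * b) (s - y)) := by
    have hsupp : Function.support (fun z : ℝ × ℝ => A (t + x) (t + x + 2 * a) (z.2 + z.1) *
      A (t - x) (t - x + 2 * b) (z.2 - z.1)) ⊆ K := by
      intro z hz
      by_contra hzK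
      refine hz ?_
      by_cases hz1 : z.2 + z.1 ∈ Icc (t + x - ε) (t + x + 2 * a + ε)
      · simp only [hAz _ _ (z.2 - z.1) (by linarith : t - x ≤ t - x + 2 * b)
          (fun h => hzK ⟨hz1, h⟩), mul_zero]
      · simp only [hAz _ _ _ (by linarith : t + x ≤ t + x + 2 * a) hz1, zero_mul]
    refine ⟨?_, HasCompactSupport.of_support_subset_isCompact hKc hsupp,
      (closure_minimal hsupp hKcl).trans hKd⟩
    have hAs : ∀ p q, ContDiff ℝ ∞ (A p q) := fun p q =>
      (hR.comp (contDiff_id.sub contDiff_const)).sub (hR.comp (contDiff_id.sub contDiff_const))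
    exact ((hAs _ _).comp (contDiff_snd.add contDiff_fst)).mul
      ((hAs _ _).comp (contDiff_snd.sub contDiff_fst))
  have hzero := hw _ htest
  simp only [wave_operator_mul (hAd _ _) (hAd' _ _) (hAd _ _) (hAd' _ _)] at hzero
  let k : ℝ × ℝ → ℝ := fun z => ρ (z.2 + z.1) * ρ (z.2 - z.1)
  have hρc := hρ.continuous
  have hk : Continuous k := by fun_prop
  have hk0 : ∀ z, 0 ≤ k z := fun z => mul_nonneg (hρ0 _) (hρ0 _)
  have hkz : ∀ z, k z ≠ 0 → dist z 0 ≤ ε := by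
    intro z hz
    have e1 : |z.2 + z.1| < ε := by
      by_contra h; exact hz (by simp only [k, hρz _ (not_lt.1 h), zero_mul])
    have e2 : |z.2 - z.1| < ε := by
      by_contra h; exact hz (by simp only [k, hρz _ (not_lt.1 h), mul_zero])
    rw [abs_lt] at e1 e2
    rw [dist_zero_right, Prod.norm_def, max_le_iff, Real.norm_eq_abs, Real.norm_eq_abs, abs_le,
      abs_le]
    refine ⟨⟨?_, ?_⟩, ?_, ?_⟩ <;> linarith
  have hkc : HasCompactSupport k := by
    refine HasCompactSupport.of_support_subset_isCompact (isCompact_closedBall (0 : ℝ × ℝ) ε) ?_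
    exact fun z hz => hkz z hz
  have hc : 0 < ∫ z, k z :=
    hk.integral_pos_of_hasCompactSupport_nonneg_nonzero hkc hk0
      (x := 0) (by simpa [k] using hρp.ne')
  have hint : ∀ z₀ : ℝ × ℝ, Integrable fun z : ℝ × ℝ => u z.1 z.2 * k (z - z₀) := fun z₀ => by
    have hkc' : HasCompactSupport fun z => k (z - z₀) :=
      hkc.comp_homeomorph (Homeomorph.subRight z₀)
    exact (hu.mul (hk.comp (continuous_id.sub continuous_const))).integrable_of_hasCompactSupport
      hkc'.mul_left
  have hsplit : ∀ z : ℝ × ℝ, u z.1 z.2 * (4 * ((ρ (z.2 + z.1 - (t + x)) -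
      ρ (z.2 + z.1 - (t + x + 2 * a))) * (ρ (z.2 - z.1 - (t - x)) -
      ρ (z.2 - z.1 - (t - x + 2 * b))))) =
      4 * (u z.1 z.2 * k (z - (x, t)) + u z.1 z.2 * k (z - (x + a - b, t + a + b))
        - u z.1 z.2 * k (z - (x + a, t + a)) - u z.1 z.2 * k (z - (x - b, t + b))) := by
    intro z
    have q1 : z.2 - t + (z.1 - x) = z.2 + z.1 - (t + x) := by ring
    have q2 : z.2 - t - (z.1 - x) = z.2 - z.1 - (t - x) := by ring
    have q3 : z.2 - (t + a + b) + (z.1 - (x + a - b)) = z.2 + z.1 - (t + x + 2 * a) := by ring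
    have q4 : z.2 - (t + a + b) - (z.1 - (x + a - b)) = z.2 - z.1 - (t - x + 2 * b) := by ring
    have q5 : z.2 - (t + a) + (z.1 - (x + a)) = z.2 + z.1 - (t + x + 2 * a) := by ring
    have q6 : z.2 - (t + a) - (z.1 - (x + a)) = z.2 - z.1 - (t - x) := by ring
    have q7 : z.2 - (t + b) + (z.1 - (x - b)) = z.2 + z.1 - (t + x) := by ring
    have q8 : z.2 - (t + b) - (z.1 - (x - b)) = z.2 - z.1 - (t - x + 2 * b) := by ring
    simp only [k, Prod.fst_sub, Prod.snd_sub, q1, q2, q3, q4, q5, q6, q7, q8]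
    ring
  have hI := (((hint (x, t)).add (hint (x + a - b, t + a + b))).sub
    (hint (x + a, t + a))).sub (hint (x - b, t + b))
  rw [domainIntegral_eq_integral hL hS] at hzero
  · simp only [hsplit] at hzero
    rw [integral_const_mul, integral_add_sub_sub (hint _) (hint _) (hint _) (hint _)] at hzero
    have hest : ∀ (z₀ : ℝ × ℝ) (ε' : ℝ), ε < ε' → (∀ z : ℝ × ℝ, dist z z₀ < ε' →
        |u z.1 z.2 - u z₀.1 z₀.2| ≤ δ) → _ := fun z₀ ε' hε' hz =>
      abs_integral_mul_sub_le hu hk hkc hk0 (z₀ := z₀) (δ := δ) fun z hz' =>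
        hz z (by simpa [dist_eq_norm] using (hkz _ hz').trans_lt hε')
    have b1 := abs_le.1 (hest _ _ g1 hu₁)
    have b2 := abs_le.1 (hest _ _ g2 hu₂)
    have b3 := abs_le.1 (hest _ _ g3 hu₃)
    have b4 := abs_le.1 (hest _ _ g4 hu₄)
    simp only at b1 b2 b3 b4
    have : |u x t + u (x + a - b) (t + a + b) - u (x + a) (t + a) - u (x - b) (t + b)| *
        ∫ z, k z ≤ 4 * δ * ∫ z, k z := by
      rw [← abs_of_pos hc, ← abs_mul, abs_of_pos hc, abs_le]
      constructor <;> linarith [b1.1, b1.2, b2.1, b2.2, b3.1, b3.2, b4.1, b4.2]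
    exact le_of_mul_le_mul_right this hc
  · simp only [hsplit]
    exact hI.const_mul 4
  · intro z hz
    have hzK : z ∉ K := fun h => hz (hKd h)
    by_cases hz1 : z.2 + z.1 ∈ Icc (t + x - ε) (t + x + 2 * a + ε)
    · have hz2 : z.2 - z.1 ∉ Icc (t - x - ε) (t - x + 2 * b + ε) := fun h => hzK ⟨hz1, h⟩
      have : ρ (z.2 - z.1 - (t - x)) = 0 ∧ ρ (z.2 - z.1 - (t - x + 2 * b)) = 0 := by
        rw [mem_Icc, not_and_or, not_le, not_le] at hz2
        constructor <;> refine hρz _ (le_abs.2 ?_) <;> rcases hz2 with h | h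
        · right; linarith
        · left; linarith
        · right; linarith
        · left; linarith
      rw [this.1, this.2]; ring
    · have : ρ (z.2 + z.1 - (t + x)) = 0 ∧ ρ (z.2 + z.1 - (t + x + 2 * a)) = 0 := by
        rw [mem_Icc, not_and_or, not_le, not_le] at hz1
        constructor <;> refine hρz _ (le_abs.2 ?_) <;> rcases hz1 with h | h
        · right; linarith
        · left; linarith
        · right; linarith
        · left; linarith
      rw [this.1, this.2]; ring

/-- By continuity, the identity extends to rectangles that touch the boundary of the domain. -/
theorem IsSolution.rectangleIdentity {L v S : ℝ} (hL : 0 < L) (hv0 : 0 < v) (hv1 : v < 1)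
    (hS : 0 < S) {φ0 φ1 : ℝ → ℝ} {φ φt : ℝ → ℝ → ℝ} (h : IsSolution L v S φ0 φ1 φ φt)
    {u : ℝ → ℝ → ℝ} (hu : Continuous (fun z : ℝ × ℝ => u z.1 z.2))
    (huφ : ∀ t ∈ Icc 0 S, ∀ x ∈ Icc (v * t) (L + v * t), u x t = φ x t) :
    RectangleIdentity L v S u := by
  intro x t a b ha hb h1 h2 h3 h4
  have hw : ∀ η, IsTest L v S η → domainIntegral L v S (fun x t => u x t *
      (iteratedDeriv 2 (fun s => η x s) t - iteratedDeriv 2 (fun y => η y t) x)) = 0 :=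
    fun η hη => by
      rw [← h.wave η hη]
      exact domainIntegral_congr hL hS fun t ht x hx => by rw [huφ t ht x hx]
  -- contract the rectangle towards the centre of the domain
  let X : ℝ → ℝ := fun r => (1 - r) * x + r * (L / 2 + v * (S / 2))
  let T : ℝ → ℝ := fun r => (1 - r) * t + r * (S / 2)
  let F : ℝ → ℝ := fun r => u (X r) (T r) +
    u (X r + (1 - r) * a - (1 - r) * b) (T r + (1 - r) * a + (1 - r) * b)
  let G : ℝ → ℝ := fun r => u (X r + (1 - r) * a) (T r + (1 - r) * a) +
    u (X r - (1 - r) * b) (T r + (1 - r) * b)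
  have huc : ∀ f g : ℝ → ℝ, Continuous f → Continuous g → Continuous fun r => u (f r) (g r) :=
    fun f g hf hg => hu.comp (hf.prodMk hg)
  have hF : Continuous F := by
    refine (huc _ _ ?_ ?_).add (huc _ _ ?_ ?_) <;> simp only [X, T] <;> fun_prop
  have hG : Continuous G := by
    refine (huc _ _ ?_ ?_).add (huc _ _ ?_ ?_) <;> simp only [X, T] <;> fun_prop
  have hev : ∀ᶠ r in 𝓝[>] (0 : ℝ), F r = G r := by
    filter_upwards [Ioo_mem_nhdsGT (zero_lt_one)] with r hr
    obtain ⟨hr0, hr1⟩ := hr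
    have hr1' : 0 < 1 - r := by linarith
    refine rectangle_identity_of_wave hL hv0 hv1 hu hw (by positivity) (by positivity) ?_ ?_ ?_ ?_
    · have : 0 ≤ (1 - r) * t := by positivity
      have : 0 < r * (S / 2) := by positivity
      simp only [T]; linarith
    · have : (1 - r) * (t + a + b) ≤ (1 - r) * S := by gcongr
      have : 0 < r * (S / 2) := by positivity
      simp only [T]; linarith
    · have : (1 - r) * (v * (t + b)) ≤ (1 - r) * (x - b) := by gcongr
      have : 0 < r * (L / 2) := by positivity
      simp only [T, X]; linarith
    · have : (1 - r) * (x + a) ≤ (1 - r) * (L + v * (t + a)) := by gcongr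
      have : 0 < r * (L / 2) := by positivity
      simp only [T, X]; linarith
  have hlim := tendsto_nhds_unique_of_eventuallyEq
    ((hF.tendsto 0).mono_left nhdsWithin_le_nhds) ((hG.tendsto 0).mono_left nhdsWithin_le_nhds) hev
  simpa [F, G, X, T] using hlim

/-! ### d'Alembert's formula -/

/-- Smooth functions with values in `[0, 1]` and support inside `(p, q)` that converge to the
indicator of `(p, q)`. -/
theorem exists_smooth_tendsto_indicator {p q : ℝ} (hpq : p < q) :
    ∃ α : ℕ → ℝ → ℝ, (∀ n, ContDiff ℝ ∞ (α n)) ∧ (∀ n x, |α n x| ≤ 1) ∧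
      (∀ n, HasCompactSupport (α n)) ∧ (∀ n, tsupport (α n) ⊆ Ioo p q) ∧
      ∀ x, Tendsto (fun n => α n x) atTop (𝓝 ((Ioo p q).indicator 1 x)) := by
  have hr : 0 < (q - p) / 2 := by linarith
  have hball : Ioo p q = Metric.ball ((p + q) / 2) ((q - p) / 2) := by
    rw [Real.ball_eq_Ioo]; congr 1 <;> ring
  have h23 : ∀ n : ℕ, 1 / ((n : ℝ) + 3) < 1 / ((n : ℝ) + 2) := fun n =>
    one_div_lt_one_div_of_lt (by positivity) (by linarith)
  have h2 : ∀ n : ℕ, 1 / ((n : ℝ) + 2) < 1 := fun n => by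
    rw [div_lt_one (by positivity)]; linarith [n.cast_nonneg (α := ℝ)]
  let α : ℕ → ContDiffBump ((p + q) / 2) := fun n =>
    { rIn := (q - p) / 2 * (1 - 1 / ((n : ℝ) + 2))
      rOut := (q - p) / 2 * (1 - 1 / ((n : ℝ) + 3))
      rIn_pos := mul_pos hr (by linarith [h2 n])
      rIn_lt_rOut := mul_lt_mul_of_pos_left (by linarith [h23 n]) hr }
  have hOut : ∀ n, (α n).rOut < (q - p) / 2 := fun n => by
    have : 0 < 1 / ((n : ℝ) + 3) := by positivity
    exact mul_lt_of_lt_one_right hr (by linarith)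
  refine ⟨fun n => α n, fun n => (α n).contDiff, fun n x => ?_, fun n => (α n).hasCompactSupport,
    fun n => ?_, fun x => ?_⟩
  · rw [abs_of_nonneg (α n).nonneg]; exact (α n).le_one
  · rw [(α n).tsupport_eq, hball]
    exact Metric.closedBall_subset_ball (hOut n)
  · by_cases hx : x ∈ Ioo p q
    · rw [indicator_of_mem hx, Pi.one_apply]
      rw [hball, Metric.mem_ball] at hx
      have hlim : Tendsto (fun n : ℕ => (q - p) / 2 * (1 - 1 / ((n : ℝ) + 2))) atTop
          (𝓝 ((q - p) / 2 * (1 - 0))) := by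
        refine Tendsto.const_mul _ (tendsto_const_nhds.sub ?_)
        exact tendsto_const_nhds.div_atTop
          (tendsto_atTop_add_const_right _ _ tendsto_natCast_atTop_atTop)
      rw [sub_zero, mul_one] at hlim
      refine tendsto_const_nhds.congr' ?_
      filter_upwards [hlim.eventually_const_lt hx] with n hn
      exact ((α n).one_of_mem_closedBall (Metric.mem_closedBall.2 hn.le)).symm
    · rw [indicator_of_notMem hx]
      refine tendsto_const_nhds.congr fun n => ((α n).zero_of_le_dist ?_).symm
      rw [hball, Metric.mem_ball, not_lt] at hx
      exact (hOut n).le.trans hx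

theorem integral_mul_indicator_Ioo {a b p q : ℝ} (hap : a ≤ p) (hpq : p ≤ q) (hqb : q ≤ b)
    (g : ℝ → ℝ) :
    ∫ x in a..b, g x * (Ioo p q).indicator 1 x = ∫ x in p..q, g x := by
  have h : ∀ x, g x * (Ioo p q).indicator 1 x = (Ioo p q).indicator g x := fun x => by
    by_cases hx : x ∈ Ioo p q <;> simp [hx]
  simp only [h]
  rw [intervalIntegral.integral_of_le (by linarith), intervalIntegral.integral_of_le hpq,
    integral_Ioc_eq_integral_Ioo, integral_Ioc_eq_integral_Ioo, integral_indicator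
    measurableSet_Ioo, Measure.restrict_restrict measurableSet_Ioo,
    inter_eq_left.2 (Ioo_subset_Ioo hap hqb)]

theorem ContinuousInL2.continuousOn_integral {L v S : ℝ} (hL : 0 < L) {u : ℝ → ℝ → ℝ}
    (hu : ContinuousInL2 L v S u) {p q : ℝ} (hpq : p ≤ q) {s : Set ℝ} (hs : s ⊆ Icc 0 S)
    (hp : ∀ t ∈ s, v * t ≤ p) (hq : ∀ t ∈ s, q ≤ L + v * t) :
    ContinuousOn (fun t => ∫ x in p..q, u x t) s := by
  have h := hu.continuousOn_integral_mul (α := (Ioo p q).indicator 1) (C := 1) hL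
    (measurable_one.indicator measurableSet_Ioo) (fun x => by
      by_cases hx : x ∈ Ioo p q <;> simp [hx]) (by
      have : ∀ᵐ x : ℝ, x ∉ ({p, q} : Set ℝ) :=
        measure_eq_zero_iff_ae_notMem.1 ((Set.toFinite {p, q}).measure_zero _)
      filter_upwards [this] with x hx
      refine continuousOn_const.continuousAt_indicator ?_
      rcases hpq.eq_or_lt with rfl | hpq
      · simp
      · rwa [frontier_Ioo hpq])
  refine (h.mono hs).congr fun t ht => ?_
  exact (integral_mul_indicator_Ioo (hp t ht) hpq (hq t ht) _).symm

/-- The relation between `φ` and its weak time derivative, integrated over a fixed space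
interval. -/
theorem IsSolution.integral_mul_deriv {L v S : ℝ} (hL : 0 < L) (hv0 : 0 < v)
    {φ0 φ1 : ℝ → ℝ} {φ φt : ℝ → ℝ → ℝ} (h : IsSolution L v S φ0 φ1 φ φt)
    {p q t₁ t₂ : ℝ} (hpq : p < q) (h1 : 0 ≤ t₁) (h12 : t₁ < t₂) (h2 : t₂ ≤ S)
    (hp : v * t₂ ≤ p) (hq : q ≤ L + v * t₁) {β : ℝ → ℝ} (hβ : ContDiff ℝ ∞ β)
    (hβc : HasCompactSupport β) (hβs : tsupport β ⊆ Ioo t₁ t₂) :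
    ∫ t in (0 : ℝ)..S, (∫ x in p..q, φ x t) * deriv β t =
      - ∫ t in (0 : ℝ)..S, (∫ x in p..q, φt x t) * β t := by
  have hS : 0 < S := by linarith
  obtain ⟨α, hα, hα1, hαc, hαs, hαlim⟩ := exists_smooth_tendsto_indicator hpq
  have hβ' : Continuous (deriv β) := hβ.continuous_deriv (by simp)
  have hz : ∀ t, t ∉ Ioo t₁ t₂ → β t = 0 ∧ deriv β t = 0 := fun t ht =>
    ⟨image_eq_zero_of_notMem_tsupport fun h' => ht (hβs h'), by
      by_contra h'
      exact ht (hβs (support_deriv_subset h'))⟩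
  have key : ∀ (g : ℝ → ℝ → ℝ) (γ : ℝ → ℝ), (∀ t, t ∉ Ioo t₁ t₂ → γ t = 0) →
      ∫ t in (0 : ℝ)..S, (∫ x in (v * t)..(L + v * t), g x t * (Ioo p q).indicator 1 x) * γ t =
        ∫ t in (0 : ℝ)..S, (∫ x in p..q, g x t) * γ t := by
    intro g γ hγ
    refine intervalIntegral.integral_congr fun t _ => ?_
    by_cases ht : t ∈ Ioo t₁ t₂
    · rw [integral_mul_indicator_Ioo _ hpq.le]
      · nlinarith [ht.1]
      · nlinarith [ht.2]
    · simp only [hγ t ht, mul_zero]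
  have l1 := h.cont.tendsto_domainIntegral hL hS (fun n => (hα n).continuous) hα1 hαlim hβ'
  have l2 := h.cont_dt.tendsto_domainIntegral hL hS (fun n => (hα n).continuous) hα1 hαlim
    hβ.continuous
  rw [key _ _ fun t ht => (hz t ht).2] at l1
  rw [key _ _ fun t ht => (hz t ht).1] at l2
  refine tendsto_nhds_unique l1 (l2.neg.congr fun n => ?_)
  have ht : IsTest L v S (fun x t => α n x * β t) := by
    have hsupp : Function.support (fun z : ℝ × ℝ => α n z.1 * β z.2) ⊆
        tsupport (α n) ×ˢ tsupport β := fun z hz =>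
      ⟨subset_tsupport _ (left_ne_zero_of_mul hz), subset_tsupport _ (right_ne_zero_of_mul hz)⟩
    refine ⟨((hα n).comp contDiff_fst).mul (hβ.comp contDiff_snd),
      HasCompactSupport.of_support_subset_isCompact ((hαc n).prod hβc) hsupp,
      (closure_minimal hsupp ((isClosed_tsupport _).prod (isClosed_tsupport _))).trans ?_⟩
    rintro ⟨x, t⟩ ⟨hx, ht⟩
    have hx' := hαs n hx
    have ht' := hβs ht
    simp only at hx' ht'
    refine ⟨⟨by simp only; linarith [ht'.1], by simp only; linarith [ht'.2]⟩, ?_, ?_⟩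
    · simp only; nlinarith [hx'.1, ht'.2]
    · simp only; nlinarith [hx'.2, ht'.1]
  have := h.weak_dt _ ht
  simp only [deriv_const_mul_field] at this
  exact this.symm

/-- The mean of `φ` over `[x - h, x + h]` at time `t` equals its mean over `[t - h, t + h]` at the
point `x`. -/
theorem RectangleIdentity.integral_eq_integral {L v S : ℝ} {u : ℝ → ℝ → ℝ}
    (hu : Continuous (fun z : ℝ × ℝ => u z.1 z.2)) (hR : RectangleIdentity L v S u)
    {x t h : ℝ} (hh : 0 ≤ h) (h1 : h ≤ t) (h2 : t + h ≤ S) (h3 : v * t ≤ x - h)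
    (h4 : x + h ≤ L + v * t) :
    ∫ y in (x - h)..(x + h), u y t = ∫ s in (t - h)..(t + h), u x s := by
  have hd : ∀ k ∈ Icc 0 h, u (x + k) t + u (x - k) t = u x (t + k) + u x (t - k) := by
    intro k hk
    have := hR x (t - k) k k hk.1 hk.1 (by linarith [hk.2]) (by linarith [hk.2])
      (by ring_nf; linarith [hk.2]) (by ring_nf; linarith [hk.2])
    ring_nf at this ⊢
    linarith
  have hfold : ∀ (g : ℝ → ℝ) (c : ℝ), Continuous g →
      ∫ y in (c - h)..(c + h), g y = ∫ k in (0 : ℝ)..h, (g (c + k) + g (c - k)) := by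
    intro g c hg
    have hi : ∀ f : ℝ → ℝ, Continuous f → ∀ a b, IntervalIntegrable f volume a b :=
      fun f hf a b => hf.intervalIntegrable a b
    rw [intervalIntegral.integral_add (hi _ (by fun_prop) _ _) (hi _ (by fun_prop) _ _),
      intervalIntegral.integral_comp_add_left, intervalIntegral.integral_comp_sub_left, add_zero,
      sub_zero, add_comm (∫ y in c..(c + h), g y), intervalIntegral.integral_add_adjacent_intervals (hi _ hg _ _)
      (hi _ hg _ _)]
  have c1 : Continuous fun y => u y t := hu.comp (continuous_id.prodMk continuous_const)
  have c2 : Continuous fun s => u x s := hu.comp (continuous_const.prodMk continuous_id)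
  rw [hfold _ x c1, hfold _ t c2]
  refine intervalIntegral.integral_congr fun k hk => ?_
  rw [uIcc_of_le hh] at hk
  exact hd k hk

/-- d'Alembert's formula across a characteristic diamond. -/
theorem IsSolution.integral_dt_eq_sub {L v S : ℝ} (hL : 0 < L) (hv0 : 0 < v)
    {φ0 φ1 : ℝ → ℝ} {φ φt : ℝ → ℝ → ℝ} (hφ : IsSolution L v S φ0 φ1 φ φt)
    {u : ℝ → ℝ → ℝ} (hu : Continuous (fun z : ℝ × ℝ => u z.1 z.2))
    (huφ : ∀ t ∈ Icc 0 S, ∀ x ∈ Icc (v * t) (L + v * t), u x t = φ x t)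
    (hR : RectangleIdentity L v S u) {x h t₁ t₂ : ℝ} (hh : 0 < h) (h1 : h ≤ t₁)
    (h2 : t₂ + h ≤ S) (h3 : v * t₂ ≤ x - h) (h4 : x + h ≤ L + v * t₁) {t : ℝ}
    (ht : t ∈ Ioo t₁ t₂) :
    ∫ y in (x - h)..(x + h), φt y t = u x (t + h) - u x (t - h) := by
  have h12 : t₁ < t₂ := ht.1.trans ht.2
  have hsub : Ioo t₁ t₂ ⊆ Icc 0 S := fun s hs => ⟨by linarith [hs.1], by linarith [hs.2]⟩
  have hp : ∀ s ∈ Ioo t₁ t₂, v * s ≤ x - h := fun s hs => by nlinarith [hs.2]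
  have hq : ∀ s ∈ Ioo t₁ t₂, x + h ≤ L + v * s := fun s hs => by nlinarith [hs.1]
  have c2 : Continuous fun s => u x s := hu.comp (continuous_const.prodMk continuous_id)
  let D : ℝ → ℝ := fun s => u x (s + h) - u x (s - h)
  have hDc : Continuous D := by
    simp only [D]
    exact (c2.comp (continuous_id.add continuous_const)).sub
      (c2.comp (continuous_id.sub continuous_const))
  have hJc := hφ.cont_dt.continuousOn_integral hL (by linarith : x - h ≤ x + h) hsub hp hq
  let B : ℝ → ℝ := fun s => ∫ r in (s - h)..(s + h), u x r
  have hB : ∀ s, HasDerivAt B (D s) s := by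
    intro s
    have hi : ∀ a b, IntervalIntegrable (fun r => u x r) volume a b := fun a b =>
      c2.intervalIntegrable a b
    have e : B = fun s => (∫ r in (0 : ℝ)..(s + h), u x r) - ∫ r in (0 : ℝ)..(s - h), u x r := by
      ext s; exact (intervalIntegral.integral_interval_sub_left (hi _ _) (hi _ _)).symm
    rw [e]
    exact ((c2.integral_hasStrictDerivAt 0 (s + h)).hasDerivAt.comp_add_const s h).sub
      ((c2.integral_hasStrictDerivAt 0 (s - h)).hasDerivAt.comp_sub_const s h)
  have hS : 0 ≤ S := by linarith
  have hae : ∀ᵐ s, s ∈ Ioo t₁ t₂ → (∫ y in (x - h)..(x + h), φt y s) - D s = 0 := by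
    refine isOpen_Ioo.ae_eq_zero_of_integral_contDiff_smul_eq_zero
      ((hJc.sub hDc.continuousOn).locallyIntegrableOn measurableSet_Ioo) fun β hβ hβc hβs => ?_
    have hz : ∀ t, t ∉ Ioo t₁ t₂ → β t = 0 ∧ deriv β t = 0 := fun t ht =>
      ⟨image_eq_zero_of_notMem_tsupport fun h' => ht (hβs h'), by
        by_contra h'
        exact ht (hβs (support_deriv_subset h'))⟩
    have hβ' : Continuous (deriv β) := hβ.continuous_deriv (by simp)
    have e1 := hφ.integral_mul_deriv hL hv0 (by linarith : x - h < x + h) (by linarith) h12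
      (by linarith) h3 h4 hβ hβc hβs
    have e2 : ∫ s in (0 : ℝ)..S, (∫ y in (x - h)..(x + h), φ y s) * deriv β s =
        ∫ s in (0 : ℝ)..S, B s * deriv β s := by
      refine intervalIntegral.integral_congr fun s _ => ?_
      by_cases hs : s ∈ Ioo t₁ t₂
      · have : ∫ y in (x - h)..(x + h), φ y s = B s := by
          simp only [B]
          rw [← hR.integral_eq_integral hu hh.le (by linarith [hs.1]) (by linarith [hs.2])
            (hp s hs) (hq s hs)]
          refine intervalIntegral.integral_congr fun y hy => ?_
          rw [uIcc_of_le (by linarith)] at hy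
          exact (huφ s (hsub hs) y ⟨by linarith [hp s hs, hy.1], by linarith [hq s hs, hy.2]⟩).symm
        simp only [this]
      · simp only [(hz s hs).2, mul_zero]
    have e3 := intervalIntegral.integral_mul_deriv_eq_deriv_mul (a := 0) (b := S)
      (fun s _ => hB s) (fun s _ => (hβ.differentiable (by simp) s).hasDerivAt)
      (hDc.intervalIntegrable _ _) (hβ'.intervalIntegrable _ _)
    rw [(hz 0 fun h' => by linarith [h'.1]).1, (hz S fun h' => by linarith [h'.2]).1] at e3
    have e4 : ∫ s in (0 : ℝ)..S, ((∫ y in (x - h)..(x + h), φt y s) - D s) * β s = 0 := by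
      have hi : IntervalIntegrable (fun s => D s * β s) volume 0 S :=
        (hDc.mul hβ.continuous).intervalIntegrable _ _
      have hi' : IntervalIntegrable (fun s => (∫ y in (x - h)..(x + h), φt y s) * β s)
          volume 0 S := by
        rw [intervalIntegrable_iff_integrableOn_Ioc_of_le hS]
        have hc : ContinuousOn (fun s => (∫ y in (x - h)..(x + h), φt y s) * β s)
            (tsupport β) := (hJc.mono hβs).mul hβ.continuous.continuousOn
        have hI := hc.integrableOn_compact (μ := volume) hβc
        rw [integrableOn_iff_integrable_of_support_subset] at hI
        · exact hI.integrableOn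
        · exact fun s hs => subset_tsupport _ (right_ne_zero_of_mul hs)
      simp only [sub_mul]
      rw [intervalIntegral.integral_sub hi' hi]
      linarith
    rw [← e4, intervalIntegral.integral_of_le hS,
      setIntegral_eq_integral_of_forall_compl_eq_zero]
    · congr 1; ext s; rw [smul_eq_mul, mul_comm]
    · intro s hs
      rw [(hz s fun h' => hs ⟨by linarith [h'.1], by linarith [h'.2]⟩).1, mul_zero]
  have heq := Measure.eqOn_open_of_ae_eq (μ := volume)
    (f := fun s => ∫ y in (x - h)..(x + h), φt y s) (g := D) (U := Ioo t₁ t₂)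
    ((ae_restrict_iff' measurableSet_Ioo).2 (hae.mono fun s hs hs' => sub_eq_zero.1 (hs hs')))
    isOpen_Ioo hJc hDc.continuousOn
  exact heq ht

/-- d'Alembert's formula on the triangle with base `[p, q]` at a positive time.  Small triangles
are half diamonds; larger ones are cut into small ones by the parallelogram identity. -/
theorem IsSolution.dAlembert_of_pos {L v S : ℝ} (hL : 0 < L) (hv0 : 0 < v) (hv1 : v < 1)
    {φ0 φ1 : ℝ → ℝ} {φ φt : ℝ → ℝ → ℝ} (hφ : IsSolution L v S φ0 φ1 φ φt)
    {u : ℝ → ℝ → ℝ} (hu : Continuous (fun z : ℝ × ℝ => u z.1 z.2))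
    (huφ : ∀ t ∈ Icc 0 S, ∀ x ∈ Icc (v * t) (L + v * t), u x t = φ x t)
    (hR : RectangleIdentity L v S u) {p q t : ℝ} (ht : 0 < t) (hpq : p < q) (hp : v * t < p)
    (hq : q < L + v * t) (hS : t + (q - p) / 2 ≤ S) :
    2 * u ((p + q) / 2) (t + (q - p) / 2) = u p t + u q t + ∫ y in p..q, φt y t := by
  obtain ⟨δ, hδ, hδt, hδS, hδp, hδq⟩ : ∃ δ > 0, δ < t / 2 ∧ δ < (S - t) / 2 ∧ δ < p - v * t ∧
      δ < L + v * t - q := by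
    have hm : 0 < min (min (t / 2) ((S - t) / 2)) (min (p - v * t) (L + v * t - q)) := by
      simp only [lt_min_iff]
      refine ⟨⟨?_, ?_⟩, ?_, ?_⟩ <;> linarith
    obtain ⟨ε, h, h'⟩ := exists_between hm
    simp only [lt_min_iff] at h'
    exact ⟨ε, h, by tauto⟩
  -- a base of length `2 h ≤ 2 δ`
  have hsmall : ∀ x h, 0 < h → h ≤ δ → p ≤ x - h → x + h ≤ q →
      2 * u x (t + h) = u (x - h) t + u (x + h) t + ∫ y in (x - h)..(x + h), φt y t := by
    intro x h h0 hd hxp hxq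
    have e1 := hφ.integral_dt_eq_sub hL hv0 hu huφ hR (x := x) (t₁ := t - δ) (t₂ := t + δ) h0
      (by linarith) (by linarith) (by nlinarith) (by nlinarith) (t := t)
      ⟨by linarith, by linarith⟩
    have e2 := hR x (t - h) h h h0.le h0.le (by linarith) (by linarith)
      (by ring_nf; linarith) (by ring_nf; linarith)
    rw [e1]
    ring_nf at e2 ⊢
    linarith
  obtain ⟨N, hN⟩ := exists_nat_gt ((q - p) / (2 * δ))
  have hN0 : (0 : ℝ) < N := lt_of_le_of_lt (div_nonneg (by linarith) (by linarith)) hN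
  set d : ℝ := (q - p) / N with hd
  have hd0 : 0 < d := div_pos (by linarith) hN0
  have hNd : N * d = q - p := by rw [hd]; field_simp
  have hdδ : d / 2 ≤ δ := by
    rw [div_lt_iff₀ (by linarith)] at hN
    have : N * d < N * (2 * δ) := by rw [hNd]; exact hN
    have := lt_of_mul_lt_mul_left this hN0.le
    linarith
  have hint : ∀ a b, p ≤ a → b ≤ q → a ≤ b → IntervalIntegrable (fun y => φt y t) volume a b :=
    fun a b ha hb hab => (hφ.cont_dt.intervalIntegrable hL ⟨ht.le, by linarith⟩).mono_set (by
      rw [uIcc_of_le hab, uIcc_of_le (by linarith)]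
      exact Icc_subset_Icc (by linarith) (by linarith))
  have key : ∀ k : ℕ, k ≤ N → 2 * u (p + k * d / 2) (t + k * d / 2) =
      u p t + u (p + k * d) t + ∫ y in p..(p + k * d), φt y t := by
    intro k
    induction k with
    | zero => intro _; simp; ring
    | succ k ih =>
      intro hk
      have ih := ih (by omega)
      have hk' : ((k : ℝ) + 1) * d ≤ q - p := by
        rw [← hNd]
        exact mul_le_mul_of_nonneg_right (by exact_mod_cast hk) hd0.le
      have hkd : 0 ≤ (k : ℝ) * d := by positivity
      have e1 := hsmall (p + k * d + d / 2) (d / 2) (by linarith) hdδ (by linarith) (by linarith)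
      have e2 := hR (p + k * d) t (d / 2) (k * d / 2) (by linarith) (by linarith) ht.le
        (by linarith) (by nlinarith) (by nlinarith)
      rw [show p + k * d + d / 2 - d / 2 = p + k * d by ring,
        show p + k * d + d / 2 + d / 2 = p + k * d + d by ring] at e1
      rw [show p + k * d - k * d / 2 = p + k * d / 2 by ring] at e2
      have e3 := intervalIntegral.integral_add_adjacent_intervals
        (hint p (p + k * d) le_rfl (by linarith) (by linarith))
        (hint (p + k * d) (p + k * d + d) (by linarith) (by linarith) (by linarith))
      rw [Nat.cast_succ, show p + (k + 1 : ℝ) * d = p + k * d + d by ring, ← e3,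
        show p + (k + 1 : ℝ) * d / 2 = p + k * d + d / 2 - k * d / 2 by ring,
        show t + (k + 1 : ℝ) * d / 2 = t + d / 2 + k * d / 2 by ring]
      linarith
  have := key N le_rfl
  rw [hNd, show p + (q - p) / 2 = (p + q) / 2 by ring, show p + (q - p) = q by ring] at this
  exact this

/-- d'Alembert's formula on the triangle with base `[p, q]` at time `0`. -/
theorem IsSolution.dAlembert {L v S : ℝ} (hL : 0 < L) (hv0 : 0 < v) (hv1 : v < 1)
    {φ0 φ1 : ℝ → ℝ} {φ φt : ℝ → ℝ → ℝ} (hS : 0 < S) (hφ : IsSolution L v S φ0 φ1 φ φt)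
    {u : ℝ → ℝ → ℝ} (hu : Continuous (fun z : ℝ × ℝ => u z.1 z.2))
    (huφ : ∀ t ∈ Icc 0 S, ∀ x ∈ Icc (v * t) (L + v * t), u x t = φ x t)
    (hR : RectangleIdentity L v S u) {p q : ℝ} (hp : 0 ≤ p) (hpq : p ≤ q) (hq : q ≤ L)
    (hqS : (q - p) / 2 ≤ S) :
    2 * u ((p + q) / 2) ((q - p) / 2) = u p 0 + u q 0 + ∫ y in p..q, φt y 0 := by
  have hopen : ∀ p q, 0 < p → p < q → q < L → (q - p) / 2 < S →
      2 * u ((p + q) / 2) ((q - p) / 2) = u p 0 + u q 0 + ∫ y in p..q, φt y 0 := by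
    intro p q hp hpq hq hqS
    have hm : 0 < min (S - (q - p) / 2) (min S (p / v)) := by
      simp only [lt_min_iff]
      exact ⟨by linarith, hS, by positivity⟩
    have hev : ∀ t ∈ Ioo 0 (min (S - (q - p) / 2) (min S (p / v))),
        t ∈ Icc 0 S ∧ v * t < p ∧ q < L + v * t ∧ t + (q - p) / 2 ≤ S := by
      rintro t ⟨ht0, ht⟩
      simp only [lt_min_iff] at ht
      refine ⟨⟨ht0.le, ht.2.1.le⟩, ?_, by nlinarith, by linarith⟩
      have := (lt_div_iff₀ hv0).1 ht.2.2
      linarith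
    have hJ : ContinuousOn (fun t => ∫ y in p..q, φt y t)
        (Ico 0 (min (S - (q - p) / 2) (min S (p / v)))) := by
      refine hφ.cont_dt.continuousOn_integral hL hpq.le ?_ ?_ ?_ <;> intro t ht
      · rcases ht.1.eq_or_lt with rfl | h0
        · exact ⟨le_rfl, hS.le⟩
        · exact (hev t ⟨h0, ht.2⟩).1
      · rcases ht.1.eq_or_lt with rfl | h0
        · linarith
        · exact (hev t ⟨h0, ht.2⟩).2.1.le
      · rcases ht.1.eq_or_lt with rfl | h0
        · linarith
        · exact (hev t ⟨h0, ht.2⟩).2.2.1.le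
    have l1 : Tendsto (fun t => ∫ y in p..q, φt y t) (𝓝[>] 0) (𝓝 (∫ y in p..q, φt y 0)) := by
      have := hJ 0 ⟨le_rfl, hm⟩
      unfold ContinuousWithinAt at this
      refine this.mono_left ?_
      rw [nhdsWithin_Ico_eq_nhdsGE hm]
      exact nhdsWithin_mono _ Ioi_subset_Ici_self
    have huc : ∀ f g : ℝ → ℝ, Continuous f → Continuous g → Continuous fun r => u (f r) (g r) :=
      fun f g hf hg => hu.comp (hf.prodMk hg)
    have l2 : Tendsto (fun t => 2 * u ((p + q) / 2) (t + (q - p) / 2) - u p t - u q t) (𝓝[>] 0)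
        (𝓝 (2 * u ((p + q) / 2) (0 + (q - p) / 2) - u p 0 - u q 0)) := by
      refine (Continuous.tendsto ?_ 0).mono_left nhdsWithin_le_nhds
      exact (((huc _ _ (by fun_prop) (by fun_prop)).const_mul 2).sub
        (huc _ _ (by fun_prop) (by fun_prop))).sub (huc _ _ (by fun_prop) (by fun_prop))
    have l3 := tendsto_nhds_unique_of_eventuallyEq l2 l1 (by
      filter_upwards [Ioo_mem_nhdsGT hm] with t ht
      obtain ⟨a1, a2, a3, a4⟩ := hev t ht
      linarith [hφ.dAlembert_of_pos hL hv0 hv1 hu huφ hR ht.1 hpq a2 a3 a4])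
    rw [zero_add] at l3
    linarith
  rcases hpq.eq_or_lt with rfl | hpq
  · rw [sub_self, zero_div, intervalIntegral.integral_same, add_self_div_two]; ring
  -- shrink `[p, q]` towards the centre of `[0, L]`
  let P : ℝ → ℝ := fun r => (1 - r) * p + r * (L / 2)
  let Q : ℝ → ℝ := fun r => (1 - r) * q + r * (L / 2)
  have hPc : Continuous P := by simp only [P]; fun_prop
  have hQc : Continuous Q := by simp only [Q]; fun_prop
  let g : ℝ → ℝ := (Ioc 0 L).indicator fun y => φt y 0
  have hg : Integrable g := by
    have := hφ.cont_dt.intervalIntegrable hL (t := 0) ⟨le_rfl, hS.le⟩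
    rw [mul_zero, add_zero, intervalIntegrable_iff_integrableOn_Ioc_of_le hL.le] at this
    exact this.integrable_indicator measurableSet_Ioc
  have hgi : ∀ a b, 0 ≤ a → a ≤ b → b ≤ L → ∫ y in a..b, φt y 0 =
      (∫ y in (0 : ℝ)..b, g y) - ∫ y in (0 : ℝ)..a, g y := by
    intro a b ha hab hb
    rw [intervalIntegral.integral_interval_sub_left hg.intervalIntegrable hg.intervalIntegrable]
    refine intervalIntegral.integral_congr_ae (Eventually.of_forall fun y hy => ?_)
    rw [uIoc_of_le hab] at hy
    have hy' : y ∈ Ioc 0 L := ⟨by linarith [hy.1], by linarith [hy.2]⟩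
    simp only [g, indicator_of_mem hy']
  have hG : Continuous fun b => ∫ y in (0 : ℝ)..b, g y :=
    intervalIntegral.continuous_primitive (fun a b => hg.intervalIntegrable) 0
  have huc : ∀ f g : ℝ → ℝ, Continuous f → Continuous g → Continuous fun r => u (f r) (g r) :=
    fun f g hf hg => hu.comp (hf.prodMk hg)
  have l1 : Continuous fun r => 2 * u ((P r + Q r) / 2) ((Q r - P r) / 2) :=
    (huc _ _ (by fun_prop) (by fun_prop)).const_mul 2
  have l2 : Continuous fun r => u (P r) 0 + u (Q r) 0 + ((∫ y in (0 : ℝ)..(Q r), g y) -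
      ∫ y in (0 : ℝ)..(P r), g y) :=
    ((huc _ _ hPc continuous_const).add (huc _ _ hQc continuous_const)).add
      ((hG.comp hQc).sub (hG.comp hPc))
  have l3 := tendsto_nhds_unique_of_eventuallyEq (l := 𝓝[>] (0 : ℝ))
    ((l1.tendsto 0).mono_left nhdsWithin_le_nhds) ((l2.tendsto 0).mono_left nhdsWithin_le_nhds)
    (by
      filter_upwards [Ioo_mem_nhdsGT (zero_lt_one' ℝ)] with r hr
      obtain ⟨hr0, hr1⟩ := hr
      have hr1' : 0 < 1 - r := by linarith
      have i1 : 0 < P r := by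
        have : 0 < r * (L / 2) := by positivity
        have : 0 ≤ (1 - r) * p := by positivity
        simp only [P]; linarith
      have i2 : P r < Q r := by
        have : (1 - r) * p < (1 - r) * q := by gcongr
        simp only [P, Q]; linarith
      have i3 : Q r < L := by
        have : (1 - r) * q ≤ (1 - r) * L := by gcongr
        have : 0 < r * (L / 2) := by positivity
        simp only [Q]; linarith
      have i4 : (Q r - P r) / 2 < S := by
        have : 0 < r * (q - p) := mul_pos hr0 (by linarith)
        simp only [P, Q]; linarith
      rw [← hgi _ _ i1.le i2.le i3.le]
      exact hopen _ _ i1 i2 i3 i4)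
  rw [← hgi (P 0) (Q 0) (by simpa [P] using hp) (by simpa [P, Q] using hpq.le)
    (by simpa [Q] using hq)] at l3
  simpa [P, Q] using l3

/-! ### Uniqueness and the travelling-wave representation -/

theorem RectangleIdentity.eq_of_top {L v S : ℝ} {ψ : ℝ → ℝ → ℝ} (hR : RectangleIdentity L v S ψ)
    {x t a b : ℝ} (ha : 0 ≤ a) (hb : 0 ≤ b) (h1 : 0 ≤ t - a - b) (h2 : t ≤ S)
    (h3 : v * (t - a) ≤ x - a) (h4 : x + b ≤ L + v * (t - b)) :
    ψ x t = ψ (x + b) (t - b) + ψ (x - a) (t - a) - ψ (x - a + b) (t - a - b) := by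
  have := hR (x - a + b) (t - a - b) a b ha hb h1 (by linarith)
    (by ring_nf at h3 ⊢; linarith) (by ring_nf at h4 ⊢; linarith)
  ring_nf at this ⊢
  linarith

/-- Above a level `τ` under which `ψ` vanishes, `ψ` is the alternating sum of its values at three
points, each under that level or on a side of the domain, so it still vanishes up to time
`τ + L / 4`. -/
theorem RectangleIdentity.eq_zero_step {L v S : ℝ} (hv0 : 0 < v) (hv1 : v < 1)
    {ψ : ℝ → ℝ → ℝ} (hR : RectangleIdentity L v S ψ)
    (hleft : ∀ t ∈ Icc 0 S, ψ (v * t) t = 0) (hright : ∀ t ∈ Icc 0 S, ψ (L + v * t) t = 0)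
    {τ : ℝ} (hτ : L / 2 ≤ τ)
    (hz : ∀ t ∈ Icc 0 S, t ≤ τ → ∀ x ∈ Icc (v * t) (L + v * t), ψ x t = 0)
    {x t : ℝ} (ht : t ∈ Icc 0 S) (htτ : τ < t) (ht' : t ≤ τ + L / 4)
    (hx : x ∈ Icc (v * t) (L + v * t)) : ψ x t = 0 := by
  obtain ⟨ht0, htS⟩ := ht
  obtain ⟨hx1, hx2⟩ := hx
  have h1v : 0 < 1 - v := by linarith
  have h1v' : 0 < 1 + v := by linarith
  have key : ∀ a b, 0 ≤ a → 0 ≤ b → a ≤ t - τ → b ≤ t - τ → t - τ ≤ a ∨ t - τ ≤ b →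
      (1 - v) * a ≤ x - v * t → (1 + v) * b ≤ L + v * t - x →
      (t - τ ≤ a ∨ (1 - v) * a = x - v * t) → (t - τ ≤ b ∨ (1 + v) * b = L + v * t - x) →
      ψ x t = 0 := by
    intro a b ha hb ha' hb' hab hA hB hcA hcB
    have va : v * a ≤ a := mul_le_of_le_one_left ha hv1.le
    have vb : 0 ≤ v * b := by positivity
    have z1 : ψ (x - a) (t - a) = 0 := by
      rcases hcA with h | h
      · exact hz _ ⟨by linarith, by linarith⟩ (by linarith) _ ⟨by linarith, by linarith⟩
      · rw [show x - a = v * (t - a) by linarith]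
        exact hleft _ ⟨by linarith, by linarith⟩
    have z2 : ψ (x + b) (t - b) = 0 := by
      rcases hcB with h | h
      · exact hz _ ⟨by linarith, by linarith⟩ (by linarith) _ ⟨by linarith, by linarith⟩
      · rw [show x + b = L + v * (t - b) by linarith]
        exact hright _ ⟨by linarith, by linarith⟩
    have z3 : ψ (x - a + b) (t - a - b) = 0 :=
      hz _ ⟨by linarith, by linarith⟩ (by rcases hab with h | h <;> linarith) _
        ⟨by linarith, by linarith⟩
    rw [hR.eq_of_top ha hb (by linarith) htS (by linarith) (by linarith), z1, z2, z3]
    ring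
  have hs : 0 ≤ t - τ := by linarith
  have hvs : v * (t - τ) ≤ t - τ := mul_le_of_le_one_left hs hv1.le
  have hvs' : 0 ≤ v * (t - τ) := by positivity
  rcases le_or_gt ((1 - v) * (t - τ)) (x - v * t) with h | h
  · rcases le_or_gt ((1 + v) * (t - τ)) (L + v * t - x) with h' | h'
    · exact key (t - τ) (t - τ) hs hs le_rfl le_rfl (.inl le_rfl) h h' (.inl le_rfl)
        (.inl le_rfl)
    · have e : (1 + v) * ((L + v * t - x) / (1 + v)) = L + v * t - x := by field_simp
      refine key (t - τ) ((L + v * t - x) / (1 + v)) hs (div_nonneg (by linarith) h1v'.le)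
        le_rfl ?_ (.inl le_rfl) h e.le (.inl le_rfl) (.inr e)
      rw [div_le_iff₀ h1v']; linarith
  · have e : (1 - v) * ((x - v * t) / (1 - v)) = x - v * t := by field_simp
    refine key ((x - v * t) / (1 - v)) (t - τ) (div_nonneg (by linarith) h1v.le) hs
      ?_ le_rfl (.inr le_rfl) e.le (by linarith) (.inr e) (.inl le_rfl)
    rw [div_le_iff₀ h1v]; linarith

/-- Uniqueness: the parallelogram identity propagates zero values from both sides of the domain
and from the triangle over `[0, L]` to the whole domain. -/
theorem RectangleIdentity.eq_zero {L v S : ℝ} (hL : 0 < L) (hv0 : 0 < v) (hv1 : v < 1)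
    {ψ : ℝ → ℝ → ℝ} (hR : RectangleIdentity L v S ψ)
    (hleft : ∀ t ∈ Icc 0 S, ψ (v * t) t = 0) (hright : ∀ t ∈ Icc 0 S, ψ (L + v * t) t = 0)
    (htri : ∀ x t, t ∈ Icc 0 S → t ≤ x → x ≤ L - t → ψ x t = 0) :
    ∀ t ∈ Icc 0 S, ∀ x ∈ Icc (v * t) (L + v * t), ψ x t = 0 := by
  have h1v : 0 < 1 - v := by linarith
  have h1v' : 0 < 1 + v := by linarith
  have key : ∀ n : ℕ, ∀ t ∈ Icc 0 S, t ≤ L / 2 + n * (L / 4) →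
      ∀ x ∈ Icc (v * t) (L + v * t), ψ x t = 0 := by
    intro n
    induction n with
    | zero =>
      rintro t ⟨ht0, htS⟩ ht x ⟨hx1, hx2⟩
      rw [Nat.cast_zero, zero_mul, add_zero] at ht
      have hvt : v * t ≤ t := mul_le_of_le_one_left ht0 hv1.le
      rcases le_or_gt t x with htx | htx
      · rcases le_or_gt x (L - t) with hxL | hxL
        · exact htri x t ⟨ht0, htS⟩ htx hxL
        · -- the right vertex lies on the right side, the bottom one on the initial line
          obtain ⟨σ, hσ⟩ : ∃ σ, (1 + v) * σ = t + x - L :=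
            ⟨(t + x - L) / (1 + v), by field_simp⟩
          have s0 : 0 < σ := pos_of_mul_pos_right (by linarith) h1v'.le
          have s1 : σ ≤ t := le_of_mul_le_mul_left (by linarith) h1v'
          have s2 : v * σ ≤ σ := mul_le_of_le_one_left s0.le hv1.le
          have s3 : 0 ≤ v * (t - σ) := mul_nonneg hv0.le (by linarith)
          have s4 : v * (t - σ) ≤ t - σ := mul_le_of_le_one_left (by linarith) hv1.le
          have s5 : 0 < v * σ := by positivity
          have e := hR.eq_of_top (x := x) (t := t) (a := σ) (b := t - σ) s0.le (by linarith)
            (by linarith) htS (by linarith) (by linarith)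
          rw [e, show x + (t - σ) = L + v * σ by linarith, show t - (t - σ) = σ by ring,
            hright σ ⟨s0.le, by linarith⟩, htri (x - σ) (t - σ) ⟨by linarith, by linarith⟩
            (by linarith) (by linarith), htri (x - σ + (t - σ)) (t - σ - (t - σ))
            ⟨by linarith, by linarith⟩ (by linarith) (by linarith)]
          ring
      · -- the left vertex lies on the left side, the bottom one on the initial line
        obtain ⟨σ, hσ⟩ : ∃ σ, (1 - v) * σ = t - x := ⟨(t - x) / (1 - v), by field_simp⟩
        have s0 : 0 < σ := pos_of_mul_pos_right (by linarith) h1v.le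
        have s1 : σ ≤ t := le_of_mul_le_mul_left (by linarith) h1v
        have s2 : v * σ ≤ σ := mul_le_of_le_one_left s0.le hv1.le
        have s3 : 0 < v * σ := by positivity
        have e := hR.eq_of_top (x := x) (t := t) (a := t - σ) (b := σ) (by linarith) s0.le
          (by linarith) htS (by linarith) (by nlinarith)
        rw [e, show x - (t - σ) = v * σ by linarith, show t - (t - σ) = σ by ring,
          hleft σ ⟨s0.le, by linarith⟩, htri (x + σ) (t - σ) ⟨by linarith, by linarith⟩
          (by linarith) (by linarith), htri (v * σ + σ) (σ - σ)
          ⟨by linarith, by linarith⟩ (by linarith) (by linarith)]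
        ring
    | succ n ih =>
      intro t ht htn x hx
      rw [Nat.cast_succ] at htn
      rcases le_or_gt t (L / 2 + n * (L / 4)) with h | h
      · exact ih t ht h x hx
      · exact hR.eq_zero_step hv0 hv1 hleft hright (le_add_of_nonneg_right (by positivity)) ih
          ht h (by linarith) hx
  intro t ht x hx
  obtain ⟨n, hn⟩ := exists_nat_gt (t / (L / 4))
  rw [div_lt_iff₀ (by positivity)] at hn
  exact key n t ht (by linarith) x hx

/-- A continuous solution is the superposition `f (t + x) - f (λ (t - x))` of a wave to the left
and its reflection, for one `f` of period `L + λ L`, `λ = (1 + v) / (1 - v)`, as soon as this holds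
on the triangle over `[0, L]`. -/
theorem RectangleIdentity.eq_travelling {L v S lam : ℝ} (hL : 0 < L) (hv0 : 0 < v) (hv1 : v < 1)
    (hlam : lam * (1 - v) = 1 + v) {u : ℝ → ℝ → ℝ} (hR : RectangleIdentity L v S u)
    (hleft : ∀ t ∈ Icc 0 S, u (v * t) t = 0) (hright : ∀ t ∈ Icc 0 S, u (L + v * t) t = 0)
    {f : ℝ → ℝ} (hf : Function.Periodic f (L + lam * L))
    (htri : ∀ x t, t ∈ Icc 0 S → t ≤ x → x ≤ L - t → u x t = f (t + x) - f (lam * (t - x))) :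
    ∀ t ∈ Icc 0 S, ∀ x ∈ Icc (v * t) (L + v * t), u x t = f (t + x) - f (lam * (t - x)) := by
  have h := RectangleIdentity.eq_zero (S := S) hL hv0 hv1
    (ψ := fun x t => u x t - (f (t + x) - f (lam * (t - x)))) ?_ ?_ ?_ ?_
  · exact fun t ht x hx => sub_eq_zero.1 (h t ht x hx)
  · intro x t a b ha hb h1 h2 h3 h4
    have := hR x t a b ha hb h1 h2 h3 h4
    simp only
    rw [show t + a + b + (x + a - b) = t + a + (x + a) by ring,
      show t + b + (x - b) = t + x by ring,
      show t + a + b - (x + a - b) = t + b - (x - b) by ring,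
      show t + a - (x + a) = t - x by ring]
    linarith
  · intro t ht
    rw [hleft t ht, show lam * (t - v * t) = t + v * t by linear_combination t * hlam]
    ring
  · intro t ht
    rw [hright t ht, ← hf (lam * (t - (L + v * t))),
      show lam * (t - (L + v * t)) + (L + lam * L) = t + (L + v * t) by
        linear_combination t * hlam]
    ring
  · intro x t ht h1 h2
    exact sub_eq_zero.2 (htri x t ht h1 h2)

/-! ### The periodic profile and the energy -/

theorem locallyIntegrable_of_intervalIntegrable {w : ℝ → ℝ}
    (h : ∀ a b, IntervalIntegrable w volume a b) : LocallyIntegrable w := fun x =>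
  ⟨Ioc (x - 1) (x + 1), Ioc_mem_nhds (by linarith) (by linarith),
    (intervalIntegrable_iff_integrableOn_Ioc_of_le (by linarith)).1 (h _ _)⟩

/-- The primitive of a periodic function with mean zero is periodic. -/
theorem periodic_primitive {w : ℝ → ℝ} {P c : ℝ} (hw : Function.Periodic w P)
    (hi : ∀ a b, IntervalIntegrable w volume a b) (h0 : ∫ s in c..(c + P), w s = 0) :
    Function.Periodic (fun s => ∫ r in (0 : ℝ)..s, w r) P := fun s => by
  simp only
  rw [← intervalIntegral.integral_add_adjacent_intervals (hi 0 s) (hi s (s + P)),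
    hw.intervalIntegral_add_eq s c, h0, add_zero]

/-- The profile of a finite-energy solution: `φ` is the superposition of a left-travelling wave and
its reflection, both given by one periodic function `f` with square integrable derivative `w`,
and the energy at time `0` is `1 + v` times the integral of `w ^ 2` over a period.

On `(0, L)` the derivative `w` is `(φ_x + φ_t) / 2` at time `0`; on `(-λ L, 0)` it comes from
`(φ_x - φ_t) / 2` by rescaling.  The primitive `f` is periodic because `φ` vanishes at `0` and at
`L`. -/
theorem IsSolution.exists_profile {L v S lam : ℝ} (hL : 0 < L) (hv0 : 0 < v) (hv1 : v < 1)
    (hS : 0 < S) (hlam : lam * (1 - v) = 1 + v)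
    {φ0 φ1 : ℝ → ℝ} {φ φt : ℝ → ℝ → ℝ} (hφ : IsSolution L v S φ0 φ1 φ φt) :
    ∃ w f : ℝ → ℝ, Function.Periodic w (L + lam * L) ∧ Function.Periodic f (L + lam * L) ∧
      (∀ a b, IntervalIntegrable w volume a b) ∧
      (∀ a b, IntervalIntegrable (fun s => w s ^ 2) volume a b) ∧
      (∀ᵐ s, HasDerivAt f (w s) s) ∧
      (∀ t ∈ Icc 0 S, ∀ x ∈ Icc (v * t) (L + v * t), φ x t = f (t + x) - f (lam * (t - x))) ∧
      energy L v φ φt 0 = (1 + v) * ∫ s in (-(lam * L))..(-(lam * L) + (L + lam * L)), w s ^ 2 := by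
  have h1v : 0 < 1 - v := by linarith
  have hlam0 : 0 < lam := pos_of_mul_pos_left (by rw [hlam]; linarith) h1v.le
  have hP : 0 < L + lam * L := by positivity
  have hlL : 0 < lam * L := by positivity
  have h0S : (0 : ℝ) ∈ Icc 0 S := ⟨le_rfl, hS.le⟩
  -- the two halves of the derivative of the profile, as functions on `(0, L)`
  let A : ℝ → ℝ := fun y => (dx φ y 0 + φt y 0) / 2
  let B : ℝ → ℝ := fun y => (dx φ y 0 - φt y 0) / 2
  have mdx : MemLp (fun y => dx φ y 0) 2 (volume.restrict (Ioo 0 L)) := by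
    simpa using hφ.cont_dx.memLp 0 h0S
  have mdt : MemLp (fun y => φt y 0) 2 (volume.restrict (Ioo 0 L)) := by
    simpa using hφ.cont_dt.memLp 0 h0S
  have mA : MemLp A 2 (volume.restrict (Ioo 0 L)) := by
    simpa [A, div_eq_inv_mul] using (mdx.add mdt).const_mul (2⁻¹ : ℝ)
  have mB : MemLp B 2 (volume.restrict (Ioo 0 L)) := by
    simpa [B, div_eq_inv_mul] using (mdx.sub mdt).const_mul (2⁻¹ : ℝ)
  have toI : ∀ g : ℝ → ℝ, MemLp g 2 (volume.restrict (Ioo 0 L)) →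
      IntervalIntegrable g volume 0 L ∧ IntervalIntegrable (fun y => g y ^ 2) volume 0 L := by
    intro g hg
    rw [intervalIntegrable_iff_integrableOn_Ioo_of_le hL.le,
      intervalIntegrable_iff_integrableOn_Ioo_of_le hL.le]
    exact ⟨hg.integrable (by norm_num), hg.integrable_sq⟩
  let w₀ : ℝ → ℝ := fun s => if 0 < s then A s else lam⁻¹ * B (-lam⁻¹ * s)
  let w : ℝ → ℝ := fun s => w₀ (toIocMod hP (-(lam * L)) s)
  have hwP : Function.Periodic w (L + lam * L) := fun s => by
    simp only [w, toIocMod_add_right]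
  have hw₀ : ∀ s ∈ Ioc (-(lam * L)) L, w s = w₀ s := fun s hs => by
    simp only [w]
    rw [(toIocMod_eq_self hP).2 ⟨hs.1, by linarith [hs.2]⟩]
  have hwA : ∀ s ∈ Ioc 0 L, w s = A s := fun s hs => by
    rw [hw₀ s ⟨by linarith [hs.1], hs.2⟩]
    simp only [w₀, if_pos hs.1]
  have hwB : ∀ s ∈ Ioc (-(lam * L)) 0, w s = lam⁻¹ * B (-lam⁻¹ * s) := fun s hs => by
    rw [hw₀ s ⟨hs.1, by linarith [hs.2]⟩]
    simp only [w₀, if_neg (not_lt.2 hs.2)]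
  have hwB' : ∀ y ∈ Ico 0 L, lam * w (-lam * y) = B y := fun y hy => by
    rw [hwB _ ⟨by nlinarith [hy.2], by nlinarith [hy.1]⟩, ← mul_assoc, mul_inv_cancel₀ hlam0.ne',
      one_mul]
    congr 1; field_simp
  -- integrability over one period, hence over every interval
  have glue : ∀ F : ℝ → ℝ → ℝ, IntervalIntegrable (fun y => F (A y) 1) volume 0 L →
      IntervalIntegrable (fun y => F (B y) lam⁻¹) volume 0 L →
      IntervalIntegrable (fun s => if 0 < s then F (A s) 1 else F (B (-lam⁻¹ * s)) lam⁻¹) volume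
        (-(lam * L)) (-(lam * L) + (L + lam * L)) := by
    intro F h1 h2
    have h3 := h2.comp_mul_left (c := -lam⁻¹)
    rw [zero_div, show L / -lam⁻¹ = -(lam * L) by field_simp] at h3
    rw [show -(lam * L) + (L + lam * L) = L by ring]
    refine IntervalIntegrable.trans (b := 0) (h3.symm.congr fun s hs => ?_)
      (h1.congr fun s hs => ?_)
    · rw [uIoc_of_le (by linarith)] at hs
      simp only [if_neg (not_lt.2 hs.2)]
    · rw [uIoc_of_le hL.le] at hs
      simp only [if_pos hs.1]
  have hwcongr : ∀ s ∈ uIoc (-(lam * L)) (-(lam * L) + (L + lam * L)), w₀ s = w s := by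
    intro s hs
    rw [uIoc_of_le (by linarith)] at hs
    exact (hw₀ s ⟨hs.1, by linarith [hs.2]⟩).symm
  have hwi : ∀ a b, IntervalIntegrable w volume a b := by
    refine hwP.intervalIntegrable hP.ne' (t := -(lam * L)) ?_
    refine (glue (fun a c => c * a) (by simpa using (toI A mA).1)
      ((toI B mB).1.const_mul _)).congr fun s hs => ?_
    rw [← hwcongr s hs]
    simp only [w₀, one_mul]
  have hwi2 : ∀ a b, IntervalIntegrable (fun s => w s ^ 2) volume a b := by
    refine Function.Periodic.intervalIntegrable (fun s => by simp only [hwP s]) hP.ne'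
      (t := -(lam * L)) ?_
    refine (glue (fun a c => (c * a) ^ 2) (by simpa using (toI A mA).2)
      (by simpa only [mul_pow] using (toI B mB).2.const_mul _)).congr fun s hs => ?_
    rw [← hwcongr s hs]
    simp only [w₀, one_mul]
    split_ifs <;> rfl
  let f : ℝ → ℝ := fun s => ∫ r in (0 : ℝ)..s, w r
  -- the profile in terms of the initial data
  have hφ0 : φ 0 0 = 0 := by simpa using (hφ.memH10 0 h0S).left
  have hφL : φ L 0 = 0 := by simpa using (hφ.memH10 0 h0S).right
  have hidx : ∀ y ∈ Icc 0 L, IntervalIntegrable (fun y => dx φ y 0) volume 0 y ∧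
      IntervalIntegrable (fun y => φt y 0) volume 0 y := fun y hy => by
    have hss : uIcc 0 y ⊆ uIcc 0 L := by
      rw [uIcc_of_le hy.1, uIcc_of_le hL.le]; exact Icc_subset_Icc_right hy.2
    exact ⟨(toI _ mdx).1.mono_set hss, (toI _ mdt).1.mono_set hss⟩
  have hac : ∀ y ∈ Icc 0 L, ∫ z in (0 : ℝ)..y, dx φ z 0 = φ y 0 := fun y hy => by
    have h1 := (hφ.memH10 0 h0S).absCont.mono (c := 0) (d := y) (by
      rw [mul_zero, add_zero, uIcc_of_le hy.1, uIcc_of_le hL.le]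
      exact Icc_subset_Icc_right hy.2)
    have h2 := h1.integral_deriv_eq_sub
    rw [hφ0, sub_zero] at h2
    exact h2
  have hfA : ∀ y ∈ Icc 0 L, f y = (φ y 0 + ∫ z in (0 : ℝ)..y, φt z 0) / 2 := fun y hy => by
    rw [← hac y hy, ← intervalIntegral.integral_add (hidx y hy).1 (hidx y hy).2,
      ← intervalIntegral.integral_div]
    refine intervalIntegral.integral_congr_ae (Eventually.of_forall fun z hz => ?_)
    rw [uIoc_of_le hy.1] at hz
    exact hwA z ⟨hz.1, hz.2.trans hy.2⟩
  have hfB : ∀ y ∈ Icc 0 L, -f (-lam * y) = (φ y 0 - ∫ z in (0 : ℝ)..y, φt z 0) / 2 :=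
    fun y hy => by
    have h1 := intervalIntegral.mul_integral_comp_mul_left (f := w) (a := 0) (b := y) (-lam)
    rw [mul_zero] at h1
    simp only [f]
    rw [← h1, neg_mul, neg_neg, ← intervalIntegral.integral_const_mul, ← hac y hy,
      ← intervalIntegral.integral_sub (hidx y hy).1 (hidx y hy).2,
      ← intervalIntegral.integral_div]
    refine intervalIntegral.integral_congr_ae ?_
    have : ∀ᵐ z : ℝ, z ≠ L := by simp [ae_iff, measure_singleton]
    filter_upwards [this] with z hzL hz
    rw [uIoc_of_le hy.1] at hz
    exact hwB' z ⟨hz.1.le, lt_of_le_of_ne (hz.2.trans hy.2) hzL⟩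
  have hmean : ∫ s in (-(lam * L))..(-(lam * L) + (L + lam * L)), w s = 0 := by
    have e1 := hfA L ⟨hL.le, le_rfl⟩
    have e2 := hfB L ⟨hL.le, le_rfl⟩
    rw [show -(lam * L) + (L + lam * L) = L by ring,
      ← intervalIntegral.integral_interval_sub_left (hwi 0 L) (hwi 0 _)]
    simp only [f, neg_mul] at e1 e2
    rw [e1]
    rw [hφL] at e2 ⊢
    linarith
  have hfP : Function.Periodic f (L + lam * L) := periodic_primitive hwP hwi hmean
  refine ⟨w, f, hwP, hfP, hwi, hwi2, ?_, ?_, ?_⟩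
  · filter_upwards [LocallyIntegrable.ae_hasDerivAt_integral
      (locallyIntegrable_of_intervalIntegrable hwi)] with s hs using hs 0
  · obtain ⟨u, hu, huφ⟩ := hφ.exists_continuous_extension hL hS
    have hR := hφ.rectangleIdentity hL hv0 hv1 hS hu huφ
    have hrep := hR.eq_travelling hL hv0 hv1 hlam
      (fun t ht => by
        rw [huφ t ht _ ⟨le_rfl, by linarith⟩]; exact (hφ.memH10 t ht).left)
      (fun t ht => by
        rw [huφ t ht _ ⟨by linarith, le_rfl⟩]; exact (hφ.memH10 t ht).right)
      hfP (fun x t ht h1 h2 => by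
        have hp : x - t ∈ Icc 0 L := ⟨by linarith, by linarith [ht.1]⟩
        have hq : t + x ∈ Icc 0 L := ⟨by linarith [ht.1], by linarith⟩
        have e1 := hφ.dAlembert hL hv0 hv1 hS hu huφ hR hp.1 (by linarith [ht.1] : x - t ≤ t + x)
          hq.2 (by linarith [ht.2])
        rw [show (x - t + (t + x)) / 2 = x by ring, show (t + x - (x - t)) / 2 = t by ring,
          huφ 0 h0S (x - t) (by simpa using hp), huφ 0 h0S (t + x) (by simpa using hq),
          ← intervalIntegral.integral_interval_sub_left (hidx _ hq).2 (hidx _ hp).2] at e1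
        have e2 := hfA _ hq
        have e3 := hfB _ hp
        rw [show -lam * (x - t) = lam * (t - x) by ring] at e3
        linarith)
    exact fun t ht x hx => (huφ t ht x hx).symm.trans (hrep t ht x hx)
  · have e1 : energy L v φ φt 0 =
        ∫ y in (0 : ℝ)..L, ((1 + v) * w y ^ 2 + (1 - v) * (lam * w (-lam * y)) ^ 2) := by
      unfold energy
      rw [mul_zero, add_zero, ← intervalIntegral.integral_const_mul]
      refine intervalIntegral.integral_congr_ae ?_
      have : ∀ᵐ z : ℝ, z ≠ L := by simp [ae_iff, measure_singleton]
      filter_upwards [this] with z hzL hz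
      rw [uIoc_of_le hL.le] at hz
      rw [hwA z hz, hwB' z ⟨hz.1.le, lt_of_le_of_ne hz.2 hzL⟩]
      simp only [A, B]
      ring
    have hiB : IntervalIntegrable (fun y => w (-lam * y) ^ 2) volume 0 L := by
      have := (hwi2 0 (-lam * L)).comp_mul_left (c := -lam)
      rwa [zero_div, mul_div_cancel_left₀ _ (neg_ne_zero.2 hlam0.ne')] at this
    have e2 := intervalIntegral.mul_integral_comp_mul_left (f := fun s => w s ^ 2) (a := 0)
      (b := L) (-lam)
    rw [mul_zero, intervalIntegral.integral_symm (-lam * L) 0, neg_mul, neg_inj,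
      neg_mul] at e2
    simp only [mul_pow] at e1
    rw [e1, intervalIntegral.integral_add ((hwi2 0 L).const_mul _)
      ((hiB.const_mul _).const_mul _), intervalIntegral.integral_const_mul,
      intervalIntegral.integral_const_mul, intervalIntegral.integral_const_mul,
      show -(lam * L) + (L + lam * L) = L by ring,
      ← intervalIntegral.integral_add_adjacent_intervals (hwi2 (-(lam * L)) 0) (hwi2 0 L),
      ← e2]
    linear_combination lam * (∫ y in (0 : ℝ)..L, w (-lam * y) ^ 2) * hlam

/-! ### Boundary traces -/

theorem ae_comp_add_mul {p : ℝ → Prop} (h : ∀ᵐ s, p s) {c : ℝ} (hc : c ≠ 0) (d : ℝ) :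
    ∀ᵐ t, p (d + c * t) := by
  have h1 : Measure.QuasiMeasurePreserving (fun t : ℝ => c * t) volume volume :=
    ⟨measurable_const_mul c, by
      rw [Real.map_volume_mul_left hc]; exact Measure.smul_absolutelyContinuous⟩
  exact ((measurePreserving_add_left volume d).quasiMeasurePreserving.comp h1).ae h

/-- At either end of the moving interval the two travelling waves add up: the boundary value of
`φ_x` is a multiple of the derivative of the profile. -/
theorem hasDerivWithinAt_bdry {L v S lam : ℝ} (hlam : lam * (1 - v) = 1 + v)
    {φ : ℝ → ℝ → ℝ} {w f : ℝ → ℝ} (hf : Function.Periodic f (L + lam * L)) (hL : 0 < L)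
    (hrep : ∀ t ∈ Icc 0 S, ∀ x ∈ Icc (v * t) (L + v * t), φ x t = f (t + x) - f (lam * (t - x)))
    {xb : ℝ} (hxb : xb = 0 ∨ xb = L) {t : ℝ} (ht : t ∈ Icc 0 S)
    (hd : HasDerivAt f (w (xb + (1 + v) * t)) (xb + (1 + v) * t)) :
    HasDerivWithinAt (fun x => φ x t) ((1 + lam) * w (xb + (1 + v) * t))
      (Icc (v * t) (L + v * t)) (xb + v * t) := by
  set W := w (xb + (1 + v) * t)
  have hd' : HasDerivAt f W (lam * (t - (xb + v * t))) := by
    rcases hxb with rfl | rfl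
    · rwa [show lam * (t - (0 + v * t)) = 0 + (1 + v) * t by linear_combination t * hlam]
    · have e : (fun s => f (s + (xb + lam * xb))) = f := funext hf
      rw [← e]
      refine HasDerivAt.comp_add_const (lam * (t - (xb + v * t))) (xb + lam * xb) ?_
      rwa [show lam * (t - (xb + v * t)) + (xb + lam * xb) = xb + (1 + v) * t by
        linear_combination t * hlam]
  have h1 : HasDerivAt (fun x => f (t + x)) W (xb + v * t) := by
    refine HasDerivAt.comp_const_add t (xb + v * t) ?_
    rwa [show t + (xb + v * t) = xb + (1 + v) * t by ring]
  have h2 : HasDerivAt (fun x => f (lam * (t - x))) (W * (lam * -1)) (xb + v * t) :=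
    HasDerivAt.comp (h₂ := f) (xb + v * t) hd'
      (((hasDerivAt_id (xb + v * t)).const_sub t).const_mul lam)
  have h3 : HasDerivWithinAt (fun x => f (t + x) - f (lam * (t - x))) ((1 + lam) * W)
      (Icc (v * t) (L + v * t)) (xb + v * t) := by
    have := (h1.sub h2).hasDerivWithinAt (s := Icc (v * t) (L + v * t))
    rwa [show W - W * (lam * -1) = (1 + lam) * W by ring] at this
  refine h3.congr (fun x hx => hrep t ht x hx) (hrep t ht _ ?_)
  rcases hxb with rfl | rfl <;> constructor <;> linarith

end TravellingString

open TravellingString in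
theorem theorem4p1 (L : ℝ) (hL : 0 < L) :
    ∃ K₁ : ℝ → ℝ → ℝ,
      ∀ (v : ℝ), 0 < v → v < 1 →
      ∀ (S : ℝ), 0 < S →
      ∀ (φ0 φ1 : ℝ → ℝ), MemH10 0 L φ0 → MemLp φ1 2 (volume.restrict (Ioo 0 L)) →
      ∀ (φ φt : ℝ → ℝ → ℝ), IsSolution L v S φ0 φ1 φ φt →
      ∀ (xb : ℝ), (xb = 0 ∨ xb = L) →
        -- the boundary value of `φ_x` exists for almost every time and is square integrable
        (∀ᵐ t ∂(volume.restrict (Ioo 0 S)),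
          DifferentiableWithinAt ℝ (fun x => φ x t) (Icc (v * t) (L + v * t)) (xb + v * t)) ∧
        MemLp (bdryDx L v φ xb) 2 (volume.restrict (Ioo 0 S)) ∧
        -- the identity over `M` periods
        (∀ M : ℕ, 1 ≤ M → M * obsTime L v ≤ S →
          ∫ t in (0 : ℝ)..(M * obsTime L v), (bdryDx L v φ xb t) ^ 2 =
            4 * M / (1 - v ^ 2) ^ 2 * energy L v φ φt 0) ∧
        -- the direct inequality
        (∀ T : ℝ, 0 ≤ T → T ≤ S →
          ∫ t in (0 : ℝ)..T, (bdryDx L v φ xb t) ^ 2 ≤ K₁ v T * energy L v φ φt 0) ∧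
        -- the observability inequality
        (∀ T : ℝ, obsTime L v ≤ T → T ≤ S →
          energy L v φ φt 0 ≤
            (1 - v ^ 2) ^ 2 / 4 * ∫ t in (0 : ℝ)..T, (bdryDx L v φ xb t) ^ 2) := by
  -- the number of periods needed to cover `[0, T]`, times the constant of one period
  refine ⟨fun v T => 4 * ((⌊T / obsTime L v⌋₊ + 1 : ℕ) : ℝ) / (1 - v ^ 2) ^ 2, ?_⟩
  intro v hv0 hv1 S hS φ0 φ1 _ _ φ φt hφ xb hxb
  have h1v : 0 < 1 - v := by linarith
  have h1v' : 0 < 1 + v := by linarith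
  have hvv : 0 < 1 - v ^ 2 := by nlinarith
  obtain ⟨lam, hlam⟩ : ∃ lam, lam * (1 - v) = 1 + v := ⟨(1 + v) / (1 - v), by field_simp⟩
  have hlam0 : 0 < lam := pos_of_mul_pos_left (by rw [hlam]; linarith) h1v.le
  obtain ⟨w, f, hwP, hfP, hwi, hwi2, hwd, hrep, hE⟩ :=
    hφ.exists_profile hL hv0 hv1 hS hlam
  set P := L + lam * L with hPdef
  have hP : 0 < P := by positivity
  have hw2P : Function.Periodic (fun s => w s ^ 2) P := fun s => by simp only [hwP s]
  have hder : ∀ᵐ t ∂(volume.restrict (Ioo 0 S)), HasDerivWithinAt (fun x => φ x t)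
      ((1 + lam) * w (xb + (1 + v) * t)) (Icc (v * t) (L + v * t)) (xb + v * t) := by
    rw [ae_restrict_iff' measurableSet_Ioo]
    filter_upwards [ae_comp_add_mul hwd h1v'.ne' xb] with t ht htS
    exact hasDerivWithinAt_bdry hlam hfP hL hrep hxb (Ioo_subset_Icc_self htS) ht
  have hbdry : ∀ᵐ t ∂(volume.restrict (Ioo 0 S)),
      bdryDx L v φ xb t = (1 + lam) * w (xb + (1 + v) * t) := by
    filter_upwards [hder] with t ht
    have hmem : xb + v * t ∈ Icc (v * t) (L + v * t) := by
      rcases hxb with rfl | rfl <;> constructor <;> linarith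
    exact ht.derivWithin (uniqueDiffOn_Icc (by linarith) _ hmem)
  have hcomp : ∀ g : ℝ → ℝ, (∀ a b, IntervalIntegrable g volume a b) →
      IntervalIntegrable (fun t => g (xb + (1 + v) * t)) volume 0 S := fun g hg => by
    have h1 : IntervalIntegrable (fun t => g (xb + t)) volume 0 ((1 + v) * S) := by
      simpa using (hg xb (xb + (1 + v) * S)).comp_add_left xb
    have := h1.comp_mul_left (c := 1 + v)
    rwa [zero_div, mul_div_cancel_left₀ _ h1v'.ne'] at this
  -- the boundary integral up to time `T`, in terms of the profile
  have hint : ∀ T, 0 ≤ T → T ≤ S → ∫ t in (0 : ℝ)..T, (bdryDx L v φ xb t) ^ 2 =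
      (1 + lam) ^ 2 / (1 + v) * ∫ s in xb..(xb + (1 + v) * T), w s ^ 2 := by
    intro T hT hTS
    have e := intervalIntegral.integral_comp_add_mul (a := 0) (b := T) (fun s => w s ^ 2)
      h1v'.ne' xb
    rw [mul_zero, add_zero, smul_eq_mul] at e
    rw [div_mul_eq_mul_div, mul_div_assoc, div_eq_inv_mul, ← e,
      ← intervalIntegral.integral_const_mul, intervalIntegral.integral_of_le hT,
      intervalIntegral.integral_of_le hT, integral_Ioc_eq_integral_Ioo,
      integral_Ioc_eq_integral_Ioo]
    refine integral_congr_ae ?_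
    filter_upwards [ae_restrict_of_ae_restrict_of_subset (Ioo_subset_Ioo_right hTS) hbdry]
      with t ht
    rw [ht, mul_pow]
  set I := ∫ s in (-(lam * L))..(-(lam * L) + P), w s ^ 2 with hI
  have hperiods : ∀ M : ℕ, ∫ s in xb..(xb + M * P), w s ^ 2 = M * I := by
    intro M
    have e := hw2P.intervalIntegral_add_zsmul_eq M xb hwi2
    simp only [zsmul_eq_mul, Int.cast_natCast] at e
    rw [e, hw2P.intervalIntegral_add_eq xb (-(lam * L))]
  have hmono : ∀ a b, 0 ≤ a → a ≤ b →
      ∫ s in xb..(xb + a), w s ^ 2 ≤ ∫ s in xb..(xb + b), w s ^ 2 := fun a b ha hab =>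
    intervalIntegral.integral_mono_interval le_rfl (by linarith) (by linarith)
      (Eventually.of_forall fun s => sq_nonneg _) (hwi2 _ _)
  have hPT : (1 + v) * obsTime L v = P := by
    have : lam = (1 + v) / (1 - v) := by field_simp; exact hlam
    rw [hPdef, this, obsTime, show 1 - v ^ 2 = (1 - v) * (1 + v) by ring]
    field_simp
    ring
  have hT0 : 0 < obsTime L v := by unfold obsTime; positivity
  have hconst : (1 + lam) ^ 2 / (1 + v) = 4 / (1 - v ^ 2) ^ 2 * (1 + v) := by
    have : lam = (1 + v) / (1 - v) := by field_simp; exact hlam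
    rw [this, show 1 - v ^ 2 = (1 - v) * (1 + v) by ring]
    field_simp
    ring
  have hc0 : 0 < (1 + lam) ^ 2 / (1 + v) := by positivity
  refine ⟨hder.mono fun t ht => ht.differentiableWithinAt, ?_, ?_, ?_, ?_⟩
  · refine MemLp.ae_eq (hbdry.mono fun t ht => ht.symm) (MemLp.const_mul ?_ (1 + lam))
    have h1 := (intervalIntegrable_iff_integrableOn_Ioo_of_le hS.le).1 (hcomp w hwi)
    have h2 := (intervalIntegrable_iff_integrableOn_Ioo_of_le hS.le).1 (hcomp _ hwi2)
    exact (memLp_two_iff_integrable_sq h1.1).2 h2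
  · intro M _ hM
    rw [hint _ (by positivity) hM,
      show (1 + v) * (M * obsTime L v) = M * P by rw [← hPT]; ring, hperiods, hE, hconst]
    ring
  · intro T hT hTS
    set M : ℕ := ⌊T / obsTime L v⌋₊ + 1 with hM
    have hTM : T ≤ M * obsTime L v := by
      have := (Nat.lt_floor_add_one (T / obsTime L v)).le
      rw [div_le_iff₀ hT0] at this
      rw [hM, Nat.cast_succ]
      exact this
    have h1 := hmono ((1 + v) * T) (M * P) (by positivity) (by
      rw [← hPT]
      calc (1 + v) * T ≤ (1 + v) * (M * obsTime L v) := by gcongr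
        _ = M * ((1 + v) * obsTime L v) := by ring)
    rw [hperiods] at h1
    rw [hint T hT hTS, hE]
    calc (1 + lam) ^ 2 / (1 + v) * ∫ s in xb..(xb + (1 + v) * T), w s ^ 2
        ≤ (1 + lam) ^ 2 / (1 + v) * (M * I) := by gcongr
      _ = 4 * M / (1 - v ^ 2) ^ 2 * ((1 + v) * I) := by rw [hconst]; ring
  · intro T hT hTS
    have hT' : 0 ≤ T := hT0.le.trans hT
    have h1 := hmono P ((1 + v) * T) hP.le (by rw [← hPT]; gcongr)
    have h2 := hperiods 1
    rw [Nat.cast_one, one_mul, one_mul] at h2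
    rw [h2] at h1
    rw [hint T hT' hTS, hE, hconst]
    calc (1 + v) * I ≤ (1 + v) * ∫ s in xb..(xb + (1 + v) * T), w s ^ 2 := by gcongr
      _ = _ := by field_simp
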